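/- \textbf{Setting.} An instance of RPC1 consists of a finite set $D$ of drivers, each of capacity one, a finite set $R$ of passengers, a finite set of feasible matches $(\eta,S)$ with $\eta\in D$, $S\subseteq R$, $|S|\le 1$, and an integer profit $w(\eta,S)$ for each match. Let $H$ be the weighted (hyper)graph whose edges are the sets $\{\eta\}\cup S$ for the feasible matches with $|S|=1$, weighted by $w$, and whose vertices are the elements of $D\cup R$ that lie on an edge; thus $H$ is a bipartite graph with edges $\{\eta,r\}$. A matching $M$ in $H$ is a set of pairwise disjoint edges, $w(M)=\sum_{e\in M}w(e)$, and $n_{\min}=\min\{|V(H)\cap D|,|V(H)\cap R|\}$. Let $c\in\mathbb Z$ be a profit target. \textbf{Algorithm ExactNF.} (1) Build the network $N$ with $V(N)=\{s,t\}\cup V(H)$, source $s$, sink $t$, all capacities $1$, and edges $(s,\eta)$ of cost $0$ for $\eta\in V(H)\cap D$, $(\eta,r)$ of cost $-w(\eta,r)$ for $\{\eta,r\}\in E(H)$, and $(r,t)$ of cost $0$ for $r\in V(H)\cap R$. (2) For every $1\le y\le n_{\min}$ compute an integral flow $f_y$ from $s$ to $t$ of value $y$ whose cost is minimum among all flows of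 value $y$, or find that there is no flow of value $y$. (3) Let $c(f_y)$ be the sum of the costs of the edges with positive flow in $f_y$. If $c(f_y)\le -c$ for some $y$, take the largest such $y$ and output the edges of $H$ with positive flow in $f_y$; otherwise report failure. \textbf{Theorem.} (a) Whichever minimum cost flows $f_y$ are chosen in step (2), the answer of ExactNF is correct: if it outputs $M$, then $M$ is a nonempty matching in $H$ with $w(M)\ge c$, and $|M|$ is maximum among all matchings $M'$ in $H$ with $w(M')\ge c$; if it reports failure, then no nonempty matching in $H$ has profit at least $c$ (so, if $c>0$, no matching at all has profit at least $c$). (b) ExactNF runs in polynomial time: there are three programs for a random access machine with integer memory cells (unit cost per operation; the only arithmetic is addition, subtraction and comparison), one for each of the steps (1), (2), (3), and a polynomial $p$, such that for every instance of RPC1, every $c$, and every order in which the drivers, passengers and edges of $H$ are listed in the input, running the three programs one after the other stores $N$, then flows $f_y$ as in (2), then the answer determined by these flows as in (3), in at most $p(|V(N)|+|E(N)|)$ steps in total. -/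

import Mathlib

namespace Ridesharing

/-! ### Flow networks -/

/-- A directed network with capacities, integer edge costs, a source and a sink. -/
structure FlowNetwork (V : Type) where
  verts : Finset V
  edges : Finset (V × V)
  cap : V × V → ℕ
  cost : V × V → ℤ
  source : V
  sink : V

namespace FlowNetwork

variable {V : Type} [DecidableEq V] (N : FlowNetwork V)

/-- Flow leaving `v` minus flow entering `v`. -/
def netOut (f : V × V → ℝ) (v : V) : ℝ :=
  (∑ e ∈ N.edges with e.1 = v, f e) - ∑ e ∈ N.edges with e.2 = v, f e

/-- A feasible (real-valued) flow from the source to the sink. -/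
structure IsFlow (f : V × V → ℝ) : Prop where
  nonneg : ∀ e, 0 ≤ f e
  le_cap : ∀ e ∈ N.edges, f e ≤ N.cap e
  eq_zero : ∀ e, e ∉ N.edges → f e = 0
  conservation : ∀ v, v ≠ N.source → v ≠ N.sink → N.netOut f v = 0

/-- The value of a flow: the net amount sent out of the source. -/
def value (f : V × V → ℝ) : ℝ := N.netOut f N.source

/-- The cost `∑ cost(e) f(e)` that a minimum cost flow minimizes. -/
def flowCost (f : V × V → ℝ) : ℝ := ∑ e ∈ N.edges, (N.cost e : ℝ) * f e

open Classical in
/-- The sum of the costs of the edges that carry positive flow. -/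
noncomputable def supportCost (f : V × V → ℝ) : ℤ := ∑ e ∈ N.edges with 0 < f e, N.cost e

/-- `f` is an integral flow of value `y` whose cost is minimum among all (also the fractional)
flows of value `y`. -/
structure IsIntegralMinCostFlow (y : ℕ) (f : V × V → ℝ) : Prop where
  isFlow : N.IsFlow f
  value_eq : N.value f = y
  integral : ∀ e, ∃ z : ℤ, f e = z
  le_cost : ∀ g, N.IsFlow g → N.value g = y → N.flowCost f ≤ N.flowCost g

end FlowNetwork

/-! ### Instances of the ridesharing problem with profit constraint -/

/-- The data of an instance, without the profit target: drivers `Fin k` with capacities, passengers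
`Fin l`, the feasible matches `(η, S)` with `η` a driver and `S` a group of passengers, and the
integer profit of every match. -/
structure Instance where
  k : ℕ
  l : ℕ
  capacity : Fin k → ℕ
  capacity_pos : ∀ i, 1 ≤ capacity i
  feasible : Finset (Fin k × Finset (Fin l))
  card_le_capacity : ∀ e ∈ feasible, e.2.card ≤ capacity e.1
  profit : Fin k × Finset (Fin l) → ℤ

/-- The vertices that the flow network is built from: source, sink, drivers, passengers. -/
inductive Node (k l : ℕ) where
  | source : Node k l
  | sink : Node k l
  | driver (i : Fin k) : Node k l
  | rider (j : Fin l) : Node k l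
  deriving DecidableEq

namespace Instance

variable (I : Instance)

/-- The restricted problem: every driver has capacity one. -/
def IsRPC1 : Prop := ∀ i, I.capacity i = 1

/-- A hyperedge `{η} ∪ S`, given by the pair `(η, S)`. -/
abbrev Edge : Type := Fin I.k × Finset (Fin I.l)

/-- The vertex set `{η} ∪ S` of the hyperedge `(η, S)`, inside the disjoint union of the drivers
and the passengers. -/
def edgeVerts (e : I.Edge) : Finset (Fin I.k ⊕ Fin I.l) := Finset.disjSum {e.1} e.2

/-- The edges of the hypergraph `H`: the feasible matches with at least one passenger. -/
def edges : Finset I.Edge := {e ∈ I.feasible | 1 ≤ e.2.card}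

/-- The vertices of `H`, isolated vertices being removed. -/
def verts : Finset (Fin I.k ⊕ Fin I.l) := I.edges.biUnion I.edgeVerts

/-- The drivers among the vertices of `H`. -/
def drivers : Finset (Fin I.k) := {i | Sum.inl i ∈ I.verts}

/-- The passengers among the vertices of `H`. -/
def riders : Finset (Fin I.l) := {j | Sum.inr j ∈ I.verts}

/-- A matching in `H`: a set of edges no two of which have a common vertex. -/
def IsMatching (M : Finset I.Edge) : Prop :=
  M ⊆ I.edges ∧ ∀ e ∈ M, ∀ e' ∈ M, e ≠ e' → Disjoint (I.edgeVerts e) (I.edgeVerts e')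

/-- The profit `w(M)`. -/
def weight (M : Finset I.Edge) : ℤ := ∑ e ∈ M, I.profit e

/-- `n_min = min(|V(H) ∩ D|, |V(H) ∩ R|)`. -/
def nMin : ℕ := min I.drivers.card I.riders.card

/-- The edges `{η, r}` of `H` as pairs `(η, r)`; these are all the edges if every driver has
capacity one. -/
def pairs : Finset (Fin I.k × Fin I.l) := {p | (p.1, {p.2}) ∈ I.edges}

/-- Step 1: the flow network `N` built from `H`. -/
def network : FlowNetwork (Node I.k I.l) where
  verts := {Node.source, Node.sink} ∪ I.drivers.image Node.driver ∪ I.riders.image Node.rider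
  edges := I.drivers.image (fun i => (Node.source, Node.driver i)) ∪
    I.pairs.image (fun p => (Node.driver p.1, Node.rider p.2)) ∪
    I.riders.image (fun j => (Node.rider j, Node.sink))
  cap := fun _ => 1
  cost := fun e => match e with
    | (Node.driver i, Node.rider j) => - I.profit (i, {j})
    | _ => 0
  source := Node.source
  sink := Node.sink

/-- Step 2: for every `1 ≤ y ≤ n_min`, `f y` is a minimum cost flow `some f_y` of value `y` in `N`,
or `none` if there is no flow of value `y`. -/
def IsMinCostFlowFamily (f : ℕ → Option (Node I.k I.l × Node I.k I.l → ℝ)) : Prop :=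
  ∀ y, 1 ≤ y → y ≤ I.nMin →
    match f y with
    | some g => I.network.IsIntegralMinCostFlow y g
    | none => ¬ ∃ g, I.network.IsFlow g ∧ I.network.value g = y

open Classical in
/-- The edges of `H` that carry positive flow. -/
noncomputable def flowEdges (g : Node I.k I.l × Node I.k I.l → ℝ) : Finset I.Edge :=
  {e ∈ I.edges | ∃ j, e.2 = {j} ∧ 0 < g (Node.driver e.1, Node.rider j)}

open Classical in
/-- Step 3: take the largest `y` for which a flow `f_y` with `c(f_y) ≤ -c` was found and output the
edges of `H` with positive flow in `f_y`; if there is no such `y`, report failure (`none`). -/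
noncomputable def exactNF (c : ℤ) (f : ℕ → Option (Node I.k I.l × Node I.k I.l → ℝ)) :
    Option (Finset I.Edge) :=
  let Y : Finset ℕ :=
    {y ∈ Finset.Icc 1 I.nMin | ∃ g, f y = some g ∧ I.network.supportCost g ≤ -c}
  if h : Y.Nonempty then (f (Y.max' h)).map I.flowEdges else none

/-- What a correct answer for the profit target `c` is. A returned `M` is a nonempty matching of
profit at least `c` and of largest size among all matchings of profit at least `c`. A report of
failure means that no nonempty matching has profit at least `c`, so no matching at all if
`c` is positive (the empty matching has profit `0`). -/
def IsCorrectAnswer (c : ℤ) : Option (Finset I.Edge) → Prop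
  | some M => M.Nonempty ∧ I.IsMatching M ∧ c ≤ I.weight M ∧
      ∀ M', I.IsMatching M' → c ≤ I.weight M' → M'.card ≤ M.card
  | none => (¬ ∃ M', I.IsMatching M' ∧ M'.Nonempty ∧ c ≤ I.weight M') ∧
      (0 < c → ¬ ∃ M', I.IsMatching M' ∧ c ≤ I.weight M')

/-- The size of the network `N`. -/
def size : ℕ := I.network.verts.card + I.network.edges.card

end Instance

/-! ### A random access machine with a step count

The memory holds integers. The only arithmetic is addition and subtraction (so that numbers grow by
a bounded number of bits per step, and unit cost is polynomially equivalent to bit cost); memory is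
divided into arrays, which are named by constants of the program and indexed by computed values. -/

namespace RAM

structure State where
  reg : ℕ → ℤ
  mem : ℕ → ℤ → ℤ

inductive Expr where
  | const (z : ℤ) : Expr
  | reg (r : ℕ) : Expr
  | load (a : ℕ) (i : Expr) : Expr
  | add (x y : Expr) : Expr
  | sub (x y : Expr) : Expr

def Expr.eval (σ : State) : Expr → ℤ
  | .const z => z
  | .reg r => σ.reg r
  | .load a i => σ.mem a (i.eval σ)
  | .add x y => x.eval σ + y.eval σ
  | .sub x y => x.eval σ - y.eval σ

/-- The number of steps that evaluating an expression takes: one per operation. -/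
def Expr.steps : Expr → ℕ
  | .const _ => 1
  | .reg _ => 1
  | .load _ i => i.steps + 1
  | .add x y => x.steps + y.steps + 1
  | .sub x y => x.steps + y.steps + 1

inductive Cond where
  | le (x y : Expr) : Cond
  | eq (x y : Expr) : Cond
  | not (b : Cond) : Cond
  | and (b b' : Cond) : Cond

def Cond.holds (σ : State) : Cond → Prop
  | .le x y => x.eval σ ≤ y.eval σ
  | .eq x y => x.eval σ = y.eval σ
  | .not b => ¬ b.holds σ
  | .and b b' => b.holds σ ∧ b'.holds σ

def Cond.steps : Cond → ℕ
  | .le x y => x.steps + y.steps + 1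
  | .eq x y => x.steps + y.steps + 1
  | .not b => b.steps + 1
  | .and b b' => b.steps + b'.steps + 1

inductive Prog where
  | skip : Prog
  | assign (r : ℕ) (x : Expr) : Prog
  | store (a : ℕ) (i x : Expr) : Prog
  | seq (P Q : Prog) : Prog
  | ite (b : Cond) (P Q : Prog) : Prog
  | loop (b : Cond) (P : Prog) : Prog

def State.setReg (σ : State) (r : ℕ) (v : ℤ) : State :=
  { σ with reg := Function.update σ.reg r v }

def State.setMem (σ : State) (a : ℕ) (i v : ℤ) : State :=
  { σ with mem := Function.update σ.mem a (Function.update (σ.mem a) i v) }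

/-- `Exec P σ τ t`: started in the state `σ`, the program `P` halts in the state `τ` after `t`
steps. `loop b P` repeats `P` while `b` holds. -/
inductive Exec : Prog → State → State → ℕ → Prop where
  | skip (σ : State) : Exec .skip σ σ 1
  | assign (r : ℕ) (x : Expr) (σ : State) :
      Exec (.assign r x) σ (σ.setReg r (x.eval σ)) (x.steps + 1)
  | store (a : ℕ) (i x : Expr) (σ : State) :
      Exec (.store a i x) σ (σ.setMem a (i.eval σ) (x.eval σ)) (i.steps + x.steps + 1)
  | seq {P Q : Prog} {σ τ ρ : State} {t u : ℕ} :
      Exec P σ τ t → Exec Q τ ρ u → Exec (.seq P Q) σ ρ (t + u)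
  | ite_true {b : Cond} {P Q : Prog} {σ τ : State} {t : ℕ} :
      b.holds σ → Exec P σ τ t → Exec (.ite b P Q) σ τ (b.steps + t + 1)
  | ite_false {b : Cond} {P Q : Prog} {σ τ : State} {t : ℕ} :
      ¬ b.holds σ → Exec Q σ τ t → Exec (.ite b P Q) σ τ (b.steps + t + 1)
  | loop_done {b : Cond} {P : Prog} {σ : State} :
      ¬ b.holds σ → Exec (.loop b P) σ σ (b.steps + 1)
  | loop_step {b : Cond} {P : Prog} {σ τ ρ : State} {t u : ℕ} :
      b.holds σ → Exec P σ τ t → Exec (.loop b P) τ ρ u →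
      Exec (.loop b P) σ ρ (b.steps + t + u + 1)

end RAM

/-! ### How the graph, the network, the flows and the answer are stored -/

/-- The number that stands for a vertex of the network in memory. -/
def Node.code {k l : ℕ} : Node k l → ℤ
  | .source => 0
  | .sink => 1
  | .driver i => (i : ℤ) + 2
  | .rider j => - (j : ℤ) - 1

namespace Instance

variable (I : Instance)

/-- The graph `H` written down as lists, in an arbitrary order: its drivers, its passengers, and its
edges. -/
structure Listing where
  driverList : List (Fin I.k)
  riderList : List (Fin I.l)
  pairList : List (Fin I.k × Fin I.l)
  nodup_drivers : driverList.Nodup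
  nodup_riders : riderList.Nodup
  nodup_pairs : pairList.Nodup
  drivers_eq : driverList.toFinset = I.drivers
  riders_eq : riderList.toFinset = I.riders
  pairs_eq : pairList.toFinset = I.pairs

/-- An array with the given initial entries and zeros elsewhere. -/
def arrayOf (L : List ℤ) (i : ℤ) : ℤ := if 0 ≤ i then L.getD i.toNat 0 else 0

/-- The input. Registers `0` to `3`: number of drivers, of passengers, of edges of `H`, and the
target `c`. Array `0`: the drivers; array `1`: the passengers; arrays `2`, `3`, `4`: the driver,
the passenger and the profit of every edge. All other cells are zero. -/
def inputState (L : I.Listing) (c : ℤ) : RAM.State where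
  reg := fun r => match r with
    | 0 => L.driverList.length
    | 1 => L.riderList.length
    | 2 => L.pairList.length
    | 3 => c
    | _ => 0
  mem := fun a => match a with
    | 0 => arrayOf (L.driverList.map fun i => ((i : ℕ) : ℤ))
    | 1 => arrayOf (L.riderList.map fun j => ((j : ℕ) : ℤ))
    | 2 => arrayOf (L.pairList.map fun p => ((p.1 : ℕ) : ℤ))
    | 3 => arrayOf (L.pairList.map fun p => ((p.2 : ℕ) : ℤ))
    | 4 => arrayOf (L.pairList.map fun p => I.profit (p.1, {p.2}))
    | _ => fun _ => 0

/-- The network is in memory, its edges being listed in the order `E`. Register `4`: number of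
edges; arrays `5`, `6`, `7`, `8`: tail, head, capacity and cost of every edge. -/
structure StoresNetwork (E : List (Node I.k I.l × Node I.k I.l)) (σ : RAM.State) : Prop where
  nodup : E.Nodup
  edges_eq : E.toFinset = I.network.edges
  count : σ.reg 4 = E.length
  tail : ∀ a (h : a < E.length), σ.mem 5 a = (E[a]).1.code
  head : ∀ a (h : a < E.length), σ.mem 6 a = (E[a]).2.code
  cap : ∀ a (h : a < E.length), σ.mem 7 a = I.network.cap E[a]
  cost : ∀ a (h : a < E.length), σ.mem 8 a = I.network.cost E[a]

/-- The flows `f_y`, `1 ≤ y ≤ n_min`, are in memory. Array `9` tells at `y` whether there is a flow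
`f_y` (`1`) or not (`0`); array `10` holds the flow values, one row of length `|E(N)|` for every
`y`. -/
def StoresFlows (E : List (Node I.k I.l × Node I.k I.l))
    (f : ℕ → Option (Node I.k I.l × Node I.k I.l → ℝ)) (σ : RAM.State) : Prop :=
  ∀ y : ℕ, 1 ≤ y → y ≤ I.nMin →
    match f y with
    | some g => σ.mem 9 y = 1 ∧
        ∀ a (h : a < E.length), ((σ.mem 10 (((y - 1) * E.length + a : ℕ) : ℤ) : ℤ) : ℝ) = g E[a]
    | none => σ.mem 9 y = 0

/-- The answer is in memory. Register `5` tells whether a matching is returned (`1`) or failure is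
reported (`0`). In the first case register `6` holds the size of the matching, and the arrays `11`
and `12` the driver and the passenger of each of its edges. -/
def StoresAnswer (σ : RAM.State) : Option (Finset I.Edge) → Prop
  | some M => σ.reg 5 = 1 ∧ ∃ L : List (Fin I.k × Fin I.l), L.Nodup ∧
      L.toFinset.image (fun p => (p.1, ({p.2} : Finset (Fin I.l)))) = M ∧
      σ.reg 6 = L.length ∧
      (∀ a (h : a < L.length), σ.mem 11 a = ((L[a]).1 : ℕ)) ∧
      ∀ a (h : a < L.length), σ.mem 12 a = ((L[a]).2 : ℕ)
  | none => σ.reg 5 = 0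

/-- The three programs `build`, `flows`, `select`, run one after the other on the input `(H, c)`,
carry out the three steps of ExactNF, within `T` steps altogether. -/
def RunsExactNF (build flows select : RAM.Prog) (L : I.Listing) (c : ℤ) (T : ℕ) : Prop :=
  ∃ (E : List (Node I.k I.l × Node I.k I.l))
    (f : ℕ → Option (Node I.k I.l × Node I.k I.l → ℝ))
    (σ₁ σ₂ σ₃ : RAM.State) (t₁ t₂ t₃ : ℕ),
    RAM.Exec build (I.inputState L c) σ₁ t₁ ∧ I.StoresNetwork E σ₁ ∧
    RAM.Exec flows σ₁ σ₂ t₂ ∧ I.IsMinCostFlowFamily f ∧ I.StoresFlows E f σ₂ ∧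
    RAM.Exec select σ₂ σ₃ t₃ ∧ I.StoresAnswer σ₃ (I.exactNF c f) ∧
    I.IsCorrectAnswer c (I.exactNF c f) ∧
    t₁ + t₂ + t₃ ≤ T

end Instance

end Ridesharing

open Ridesharing

/-! Part (a). All capacities are one, so an integral flow takes only the values 0 and 1.
Conservation at the drivers and passengers then forces the pairs carrying flow to form a matching,
whose size is the value of the flow and whose profit is minus its cost (`isPairMatching_flowPairs`,
`card_flowPairs`, `weight_flowEdges`). Conversely, a matching of size `y` induces a flow of value
`y` (`pairFlow`), with which `f_y` has to compete. Hence a nonempty matching of size `y` and profit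
at least `c` exists exactly when `f_y` exists and costs at most `-c`, and the largest such `y` is
the largest size of a matching meeting the target.

Part (b). Step 2 is done by successive augmentation with potentials. The memory holds a 0/1 flow and
a potential for which no residual arc has negative reduced cost (`ArcList.Feasible`). A phase grows
a tree of residual arcs of reduced cost zero from the source; whenever a new vertex is added, the
potential on the reached vertices is lowered by the least reduced cost of a leaving arc, which keeps
feasibility (`Feasible.lower`, `Reached.extend`). If the sink has been reached, reversing the tree
path to it raises the value by one and keeps feasibility (`Feasible.flip`, `Augmenting.step`).
Otherwise the reached set is closed under residual arcs and is a saturated cut.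

Optimality is read off from these certificates by weak duality: by `sum_potential_diff`, a potential
contributes the same amount to all flows of the same value. So a feasible potential proves
minimality even among fractional flows (`isIntegralMinCostFlow`), and the indicator of a saturated
cut excludes larger values (`not_exists_flow`).

The programs are verified with Hoare-style rules for `Runs`, which carry step bounds; `Exec.frame`
supplies everything that a program leaves untouched. With `m` edges at most `2 * m + 1` vertices are
ever reached, each at cost linear in `m`, so a phase is quadratic, and at most `n_min` phases give a
cubic bound. -/

namespace Ridesharing

/-! ### Sums over the edges of a flow network -/

namespace FlowNetwork

/-- Step 3 tests the support cost while step 2 minimizes the linear cost; this is the bridge between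
the two. -/
theorem supportCost_eq_flowCost {V : Type} (N : FlowNetwork V) {f : V × V → ℝ}
    (h : ∀ e, f e = 0 ∨ f e = 1) :
    (N.supportCost f : ℝ) = N.flowCost f := by
  classical
  simp only [supportCost, flowCost, Finset.sum_filter, Int.cast_sum]
  refine Finset.sum_congr rfl fun e _ => ?_
  rcases h e with h | h <;> simp [h]

variable {V : Type} [DecidableEq V] (N : FlowNetwork V)

theorem netOut_eq_sum (f : V × V → ℝ) (v : V) :
    N.netOut f v =
      ∑ e ∈ N.edges, f e * ((if e.1 = v then 1 else 0) - (if e.2 = v then 1 else 0)) := by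
  simp only [netOut, Finset.sum_filter, ← Finset.sum_sub_distrib]
  refine Finset.sum_congr rfl fun e _ => ?_
  split_ifs <;> simp

/-- Weighing the net outflow of a flow by a function on the vertices. -/
theorem sum_potential_diff {f : V × V → ℝ} (hf : N.IsFlow f) (hst : N.source ≠ N.sink)
    (φ : V → ℝ) :
    ∑ e ∈ N.edges, f e * (φ e.1 - φ e.2) = (φ N.source - φ N.sink) * N.value f := by
  classical
  let A : Finset V := N.edges.image Prod.fst ∪ N.edges.image Prod.snd ∪ {N.source, N.sink}
  have key : ∀ ψ : V → ℝ,
      ∑ e ∈ N.edges, f e * (ψ e.1 - ψ e.2) = ∑ v ∈ A, ψ v * N.netOut f v := by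
    intro ψ
    simp only [netOut_eq_sum, Finset.mul_sum]
    rw [Finset.sum_comm]
    refine Finset.sum_congr rfl fun e he => ?_
    have h1 : e.1 ∈ A := by
      simp only [A, Finset.mem_union]; exact .inl (.inl (Finset.mem_image_of_mem _ he))
    have h2 : e.2 ∈ A := by
      simp only [A, Finset.mem_union]; exact .inl (.inr (Finset.mem_image_of_mem _ he))
    have : ∀ v, ψ v * (f e * ((if e.1 = v then 1 else 0) - (if e.2 = v then 1 else 0))) =
        (if e.1 = v then f e * ψ v else 0) - (if e.2 = v then f e * ψ v else 0) := by
      intro v; split_ifs <;> ring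
    simp only [this, Finset.sum_sub_distrib, Finset.sum_ite_eq, h1, h2, if_true]
    ring
  have two : ∀ ψ : V → ℝ, ∑ v ∈ A, ψ v * N.netOut f v =
      ψ N.source * N.netOut f N.source + ψ N.sink * N.netOut f N.sink := by
    intro ψ
    rw [← Finset.sum_subset (s₁ := {N.source, N.sink}), Finset.sum_pair hst]
    · exact Finset.subset_union_right
    · intro v _ hv
      simp only [Finset.mem_insert, Finset.mem_singleton, not_or] at hv
      rw [hf.conservation v hv.1 hv.2, mul_zero]
  -- The constant potential shows that the net outflows of source and sink cancel.
  have h0 := (key fun _ => 1).trans (two _)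
  simp only [sub_self, mul_zero, Finset.sum_const_zero, one_mul] at h0
  rw [key, two, value]
  linear_combination (-φ N.sink) * h0

/-- Flows with integral values on a network with unit capacities take the values `0` and `1`. -/
theorem IsFlow.eq_zero_or_one {N : FlowNetwork V} {f : V × V → ℝ} (hf : N.IsFlow f)
    (hc : ∀ e ∈ N.edges, N.cap e = 1) (hi : ∀ e, ∃ z : ℤ, f e = z) (e : V × V) :
    f e = 0 ∨ f e = 1 := by
  by_cases he : e ∈ N.edges
  · obtain ⟨z, hz⟩ := hi e
    have h0 := hf.nonneg e
    have h1 := hf.le_cap e he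
    rw [hc e he, hz] at h1
    rw [hz] at h0 ⊢
    norm_cast at *
    omega
  · exact .inl (hf.eq_zero e he)

end FlowNetwork

namespace Instance

variable {I : Instance}

/-! ### The graph of an instance with unit capacities -/

theorem mem_pairs {p : Fin I.k × Fin I.l} : p ∈ I.pairs ↔ (p.1, {p.2}) ∈ I.edges := by
  simp [pairs]

theorem IsRPC1.exists_singleton (hI : I.IsRPC1) {e : I.Edge} (he : e ∈ I.edges) :
    ∃ j, e.2 = {j} := by
  simp only [edges, Finset.mem_filter] at he
  have := I.card_le_capacity e he.1
  rw [hI] at this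
  exact Finset.card_eq_one.1 (le_antisymm this he.2)

theorem pairEdge_injective {k l : ℕ} :
    Function.Injective fun p : Fin k × Fin l => (p.1, ({p.2} : Finset (Fin l))) := by
  rintro ⟨i, j⟩ ⟨i', j'⟩ h
  simpa using h

theorem mem_drivers (hI : I.IsRPC1) {i : Fin I.k} : i ∈ I.drivers ↔ ∃ j, (i, j) ∈ I.pairs := by
  simp only [drivers, verts, Finset.mem_filter, Finset.mem_univ, true_and, Finset.mem_biUnion,
    edgeVerts, Finset.inl_mem_disjSum, Finset.mem_singleton, mem_pairs]
  constructor
  · rintro ⟨e, he, rfl⟩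
    obtain ⟨j, hj⟩ := hI.exists_singleton he
    exact ⟨j, hj ▸ he⟩
  · rintro ⟨j, hj⟩
    exact ⟨_, hj, rfl⟩

theorem mem_riders (hI : I.IsRPC1) {j : Fin I.l} : j ∈ I.riders ↔ ∃ i, (i, j) ∈ I.pairs := by
  simp only [riders, verts, Finset.mem_filter, Finset.mem_univ, true_and, Finset.mem_biUnion,
    edgeVerts, Finset.inr_mem_disjSum, mem_pairs]
  constructor
  · rintro ⟨e, he, hj⟩
    obtain ⟨j', hj'⟩ := hI.exists_singleton he
    rw [hj', Finset.mem_singleton] at hj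
    subst hj
    exact ⟨e.1, hj' ▸ he⟩
  · rintro ⟨i, hi⟩
    exact ⟨_, hi, by simp⟩

/-- A set of pairs `(η, r)` no two of which share a driver or a passenger. -/
structure IsPairMatching (P : Finset (Fin I.k × Fin I.l)) : Prop where
  subset : P ⊆ I.pairs
  fst : Set.InjOn Prod.fst (P : Set (Fin I.k × Fin I.l))
  snd : Set.InjOn Prod.snd (P : Set (Fin I.k × Fin I.l))

/-- The edges of `H` that belong to the given pairs. -/
def pairEdges (P : Finset (Fin I.k × Fin I.l)) : Finset I.Edge :=
  P.image fun p => (p.1, {p.2})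

theorem card_pairEdges (P : Finset (Fin I.k × Fin I.l)) : (pairEdges P).card = P.card :=
  Finset.card_image_of_injective _ pairEdge_injective

theorem weight_pairEdges (P : Finset (Fin I.k × Fin I.l)) :
    I.weight (pairEdges P) = ∑ p ∈ P, I.profit (p.1, {p.2}) :=
  Finset.sum_image fun _ _ _ _ h => pairEdge_injective h

theorem IsPairMatching.isMatching {P : Finset (Fin I.k × Fin I.l)} (hP : IsPairMatching P) :
    I.IsMatching (pairEdges P) := by
  refine ⟨fun e he => ?_, ?_⟩
  · obtain ⟨p, hp, rfl⟩ := Finset.mem_image.1 he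
    exact mem_pairs.1 (hP.subset hp)
  · intro e he e' he' hne
    obtain ⟨p, hp, rfl⟩ := Finset.mem_image.1 he
    obtain ⟨q, hq, rfl⟩ := Finset.mem_image.1 he'
    have hpq : p ≠ q := fun h => hne (by rw [h])
    rw [Finset.disjoint_left]
    rintro (i | j) h h'
    · simp only [edgeVerts, Finset.inl_mem_disjSum, Finset.mem_singleton] at h h'
      exact hpq (hP.fst hp hq (h.symm.trans h'))
    · simp only [edgeVerts, Finset.inr_mem_disjSum, Finset.mem_singleton] at h h'
      exact hpq (hP.snd hp hq (h.symm.trans h'))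

/-- Capacity one makes every edge of `H` a pair, so matchings can be handled as sets of pairs on
which both projections are injective. -/
theorem IsMatching.exists_pairs (hI : I.IsRPC1) {M : Finset I.Edge} (hM : I.IsMatching M) :
    ∃ P, IsPairMatching P ∧ pairEdges P = M := by
  classical
  have key : ∀ {p q : Fin I.k × Fin I.l}, (p.1, {p.2}) ∈ M → (q.1, {q.2}) ∈ M →
      (p.1 = q.1 ∨ p.2 = q.2) → p = q := by
    intro p q hp hq h
    by_contra hne
    have := hM.2 _ hp _ hq (fun h' => hne (pairEdge_injective h'))
    rw [Finset.disjoint_left] at this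
    rcases h with h | h
    · exact this (a := Sum.inl p.1) (by simp [edgeVerts]) (by simp [edgeVerts, h])
    · exact this (a := Sum.inr p.2) (by simp [edgeVerts]) (by simp [edgeVerts, h])
  refine ⟨{p ∈ I.pairs | (p.1, {p.2}) ∈ M}, ⟨Finset.filter_subset _ _, ?_, ?_⟩, ?_⟩
  · intro p hp q hq h
    simp only [Finset.coe_filter, Set.mem_ofPred_eq] at hp hq
    exact key hp.2 hq.2 (.inl h)
  · intro p hp q hq h
    simp only [Finset.coe_filter, Set.mem_ofPred_eq] at hp hq
    exact key hp.2 hq.2 (.inr h)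
  · ext e
    simp only [pairEdges, Finset.mem_image, Finset.mem_filter]
    constructor
    · rintro ⟨p, ⟨-, hp⟩, rfl⟩
      exact hp
    · intro he
      obtain ⟨j, hj⟩ := hI.exists_singleton (hM.1 he)
      have : e = (e.1, {j}) := by rw [← hj]
      exact ⟨(e.1, j), ⟨mem_pairs.2 (this ▸ hM.1 he), this ▸ he⟩, this.symm⟩

theorem IsPairMatching.card_le_nMin (hI : I.IsRPC1) {P : Finset (Fin I.k × Fin I.l)}
    (hP : IsPairMatching P) : P.card ≤ I.nMin := by
  refine le_min ?_ ?_
  · exact Finset.card_le_card_of_injOn Prod.fst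
      (fun p hp => (mem_drivers hI).2 ⟨p.2, hP.subset hp⟩) hP.fst
  · exact Finset.card_le_card_of_injOn Prod.snd
      (fun p hp => (mem_riders hI).2 ⟨p.1, hP.subset hp⟩) hP.snd

/-! ### Flows in the network and matchings -/

theorem sum_network_edges {α : Type*} [AddCommMonoid α] (F : Node I.k I.l × Node I.k I.l → α) :
    ∑ e ∈ I.network.edges, F e =
      ∑ i ∈ I.drivers, F (.source, .driver i) + ∑ p ∈ I.pairs, F (.driver p.1, .rider p.2) +
        ∑ j ∈ I.riders, F (.rider j, .sink) := by
  simp only [network]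
  rw [Finset.sum_union, Finset.sum_union, Finset.sum_image, Finset.sum_image, Finset.sum_image]
  · intro i _ j _ h; simpa using h
  · rintro ⟨i, j⟩ _ ⟨i', j'⟩ _ h; simpa using h
  · intro i _ j _ h; simpa using h
  · rw [Finset.disjoint_left]
    intro e h h'
    obtain ⟨i, -, rfl⟩ := Finset.mem_image.1 h
    obtain ⟨p, -, hp⟩ := Finset.mem_image.1 h'
    simp at hp
  · rw [Finset.disjoint_left]
    intro e h h'
    obtain ⟨j, -, rfl⟩ := Finset.mem_image.1 h'
    rcases Finset.mem_union.1 h with h | h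
    · obtain ⟨i, -, hp⟩ := Finset.mem_image.1 h
      simp at hp
    · obtain ⟨p, -, hp⟩ := Finset.mem_image.1 h
      simp at hp

theorem netOut_source (f : Node I.k I.l × Node I.k I.l → ℝ) :
    I.network.netOut f .source = ∑ i ∈ I.drivers, f (.source, .driver i) := by
  simp [FlowNetwork.netOut_eq_sum, sum_network_edges]

theorem netOut_driver (f : Node I.k I.l × Node I.k I.l → ℝ) (i : Fin I.k) :
    I.network.netOut f (.driver i) = ∑ p ∈ I.pairs with p.1 = i, f (.driver p.1, .rider p.2) -
      if i ∈ I.drivers then f (.source, .driver i) else 0 := by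
  simp [FlowNetwork.netOut_eq_sum, sum_network_edges, Finset.sum_filter, neg_add_eq_sub]

theorem netOut_rider (f : Node I.k I.l × Node I.k I.l → ℝ) (j : Fin I.l) :
    I.network.netOut f (.rider j) = (if j ∈ I.riders then f (.rider j, .sink) else 0) -
      ∑ p ∈ I.pairs with p.2 = j, f (.driver p.1, .rider p.2) := by
  simp [FlowNetwork.netOut_eq_sum, sum_network_edges, Finset.sum_filter, neg_add_eq_sub]

theorem driver_rider_mem_edges {i : Fin I.k} {j : Fin I.l} :
    (Node.driver i, Node.rider j) ∈ I.network.edges ↔ (i, j) ∈ I.pairs := by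
  simp [network]

theorem source_driver_mem_edges {i : Fin I.k} :
    (Node.source, Node.driver i) ∈ I.network.edges ↔ i ∈ I.drivers := by
  simp [network]

theorem rider_sink_mem_edges {j : Fin I.l} :
    (Node.rider j, Node.sink) ∈ I.network.edges ↔ j ∈ I.riders := by
  simp [network]

theorem mem_network_edges {e : Node I.k I.l × Node I.k I.l} :
    e ∈ I.network.edges ↔ (∃ i ∈ I.drivers, e = (.source, .driver i)) ∨
      (∃ p ∈ I.pairs, e = (.driver p.1, .rider p.2)) ∨ ∃ j ∈ I.riders, e = (.rider j, .sink) := by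
  simp only [network, Finset.mem_union, Finset.mem_image, or_assoc, eq_comm]

theorem flowCost_network (f : Node I.k I.l × Node I.k I.l → ℝ) :
    I.network.flowCost f =
      - ∑ p ∈ I.pairs, (I.profit (p.1, {p.2}) : ℝ) * f (.driver p.1, .rider p.2) := by
  simp [FlowNetwork.flowCost, sum_network_edges]
  simp [network]

open Classical in
/-- The pairs `(η, r)` that carry positive flow. -/
noncomputable def flowPairs (f : Node I.k I.l × Node I.k I.l → ℝ) :
    Finset (Fin I.k × Fin I.l) :=
  {p ∈ I.pairs | 0 < f (.driver p.1, .rider p.2)}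

theorem flowEdges_eq (f : Node I.k I.l × Node I.k I.l → ℝ) :
    I.flowEdges f = pairEdges (flowPairs f) := by
  classical
  ext e
  simp only [flowEdges, flowPairs, pairEdges, Finset.mem_filter, Finset.mem_image, mem_pairs]
  constructor
  · rintro ⟨he, j, hj, h⟩
    exact ⟨(e.1, j), ⟨by rw [← hj]; exact he, h⟩, by rw [← hj]⟩
  · rintro ⟨p, ⟨hp, h⟩, rfl⟩
    exact ⟨hp, p.2, rfl, h⟩

/-- A flow with values `0` and `1` selects a matching. -/
theorem isPairMatching_flowPairs (hI : I.IsRPC1) {f : Node I.k I.l × Node I.k I.l → ℝ}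
    (hf : I.network.IsFlow f) (h01 : ∀ e, f e = 0 ∨ f e = 1) : IsPairMatching (flowPairs f) := by
  classical
  -- Two different pairs with positive flow would each carry one unit, giving a sum of at least 2.
  have two : ∀ (A : Finset (Fin I.k × Fin I.l)) (p q : Fin I.k × Fin I.l), p ∈ A → q ∈ A →
      0 < f (.driver p.1, .rider p.2) → 0 < f (.driver q.1, .rider q.2) →
      ∑ r ∈ A, f (.driver r.1, .rider r.2) ≤ 1 → p = q := by
    intro A p q hp hq hfp hfq h1
    by_contra hne
    have h2 := Finset.sum_le_sum_of_subset_of_nonneg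
      (f := fun r : Fin I.k × Fin I.l => f (.driver r.1, .rider r.2))
      (s := {p, q}) (t := A) (by simp [Finset.insert_subset_iff, hp, hq])
      (fun r _ _ => hf.nonneg _)
    rw [Finset.sum_pair hne] at h2
    rcases h01 (.driver p.1, .rider p.2) with h | h <;>
      rcases h01 (.driver q.1, .rider q.2) with h' | h' <;> linarith
  refine ⟨Finset.filter_subset _ _, ?_, ?_⟩
  · intro p hp q hq h
    simp only [flowPairs, Finset.coe_filter, Set.mem_ofPred_eq] at hp hq
    have hd : p.1 ∈ I.drivers := (mem_drivers hI).2 ⟨p.2, hp.1⟩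
    -- What leaves the driver equals what enters it from the source, which is at most one.
    have hcons := hf.conservation (.driver p.1) (by simp [network]) (by simp [network])
    rw [netOut_driver, if_pos hd] at hcons
    have hcap := hf.le_cap _ (source_driver_mem_edges.2 hd)
    refine two {r ∈ I.pairs | r.1 = p.1} p q ?_ ?_ hp.2 hq.2 ?_
    · simp [hp.1]
    · simp [hq.1, h]
    · simp only [network, Nat.cast_one] at hcap
      linarith
  · intro p hp q hq h
    simp only [flowPairs, Finset.coe_filter, Set.mem_ofPred_eq] at hp hq
    have hd : p.2 ∈ I.riders := (mem_riders hI).2 ⟨p.1, hp.1⟩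
    have hcons := hf.conservation (.rider p.2) (by simp [network]) (by simp [network])
    rw [netOut_rider, if_pos hd] at hcons
    have hcap := hf.le_cap _ (rider_sink_mem_edges.2 hd)
    refine two {r ∈ I.pairs | r.2 = p.2} p q ?_ ?_ hp.2 hq.2 ?_
    · simp [hp.1]
    · simp [hq.1, h]
    · simp only [network, Nat.cast_one] at hcap
      linarith

/-- Group the pairs by driver: conservation identifies the flow leaving each driver with the flow on
its source edge, and these add up to the value. -/
theorem card_flowPairs (hI : I.IsRPC1) {f : Node I.k I.l × Node I.k I.l → ℝ}
    (hf : I.network.IsFlow f) (h01 : ∀ e, f e = 0 ∨ f e = 1) :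
    ((flowPairs f).card : ℝ) = I.network.value f := by
  classical
  have h1 : ((flowPairs f).card : ℝ) = ∑ p ∈ I.pairs, f (.driver p.1, .rider p.2) := by
    rw [flowPairs, Finset.card_filter, Nat.cast_sum]
    refine Finset.sum_congr rfl fun p _ => ?_
    rcases h01 (.driver p.1, .rider p.2) with h | h <;> simp [h]
  rw [h1, FlowNetwork.value]
  change _ = I.network.netOut f .source
  rw [netOut_source, ← Finset.sum_fiberwise_of_maps_to (t := I.drivers) (g := Prod.fst)
    (fun p hp => (mem_drivers hI).2 ⟨p.2, hp⟩)]
  refine Finset.sum_congr rfl fun i hi => ?_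
  have hcons := hf.conservation (.driver i) (by simp [network]) (by simp [network])
  rw [netOut_driver, if_pos hi] at hcons
  linarith

theorem weight_flowEdges {f : Node I.k I.l × Node I.k I.l → ℝ} (h01 : ∀ e, f e = 0 ∨ f e = 1) :
    I.weight (I.flowEdges f) = - I.network.supportCost f := by
  classical
  have h : ((I.weight (I.flowEdges f) : ℤ) : ℝ) = (- I.network.supportCost f : ℤ) := by
    rw [Int.cast_neg, FlowNetwork.supportCost_eq_flowCost _ h01, flowCost_network, neg_neg,
      flowEdges_eq, weight_pairEdges, flowPairs, Finset.sum_filter, Int.cast_sum]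
    refine Finset.sum_congr rfl fun p _ => ?_
    rcases h01 (.driver p.1, .rider p.2) with h | h <;> simp [h]
  exact_mod_cast h

/-- The flow that a matching induces. -/
def pairFlow (P : Finset (Fin I.k × Fin I.l)) : Node I.k I.l × Node I.k I.l → ℝ
  | (.source, .driver i) => ({p ∈ P | p.1 = i}.card : ℝ)
  | (.driver i, .rider j) => if (i, j) ∈ P then 1 else 0
  | (.rider j, .sink) => ({p ∈ P | p.2 = j}.card : ℝ)
  | _ => 0

/-- On source and sink edges `pairFlow` counts the matched pairs at the vertex, so conservation
equates two cardinalities, and the capacity bound is the injectivity of a projection. -/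
theorem IsPairMatching.isFlow_pairFlow (hI : I.IsRPC1) {P : Finset (Fin I.k × Fin I.l)}
    (hP : IsPairMatching P) : I.network.IsFlow (pairFlow P) where
  nonneg := by
    rintro ⟨_ | _ | i | j, _ | _ | i' | j'⟩ <;> simp only [pairFlow] <;> positivity
  le_cap := by
    intro e he
    rcases mem_network_edges.1 he with ⟨i, -, rfl⟩ | ⟨p, -, rfl⟩ | ⟨j, -, rfl⟩
    · simp only [pairFlow, network, Nat.cast_le, Finset.card_le_one, Finset.mem_filter]
      rintro p ⟨hp, hpi⟩ q ⟨hq, hqi⟩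
      exact hP.fst hp hq (hpi.trans hqi.symm)
    · simp only [pairFlow, network]
      split_ifs <;> simp
    · simp only [pairFlow, network, Nat.cast_le, Finset.card_le_one, Finset.mem_filter]
      rintro p ⟨hp, hpi⟩ q ⟨hq, hqi⟩
      exact hP.snd hp hq (hpi.trans hqi.symm)
  eq_zero := by
    rintro ⟨_ | _ | i | j, _ | _ | i' | j'⟩ he <;> simp only [pairFlow]
    · rw [source_driver_mem_edges, mem_drivers hI] at he
      push Not at he
      simp only [Nat.cast_eq_zero, Finset.card_eq_zero, Finset.filter_eq_empty_iff]
      rintro p hp rfl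
      exact he p.2 (hP.subset hp)
    · rw [driver_rider_mem_edges] at he
      exact if_neg fun h => he (hP.subset h)
    · rw [rider_sink_mem_edges, mem_riders hI] at he
      push Not at he
      simp only [Nat.cast_eq_zero, Finset.card_eq_zero, Finset.filter_eq_empty_iff]
      rintro p hp rfl
      exact he p.1 (hP.subset hp)
  conservation := by
    rintro (_ | _ | i | j) hs ht
    · exact absurd rfl hs
    · exact absurd rfl ht
    · rw [netOut_driver]
      split_ifs with hi
      · simp only [pairFlow, Finset.sum_boole, Finset.filter_filter, sub_eq_zero, Nat.cast_inj]
        congr 1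
        ext p
        have := @hP.subset p
        simp only [Finset.mem_filter]
        tauto
      · rw [Finset.sum_eq_zero, sub_zero]
        intro p hp
        simp only [Finset.mem_filter] at hp
        exact absurd ((mem_drivers hI).2 ⟨p.2, hp.1⟩) (hp.2 ▸ hi)
    · rw [netOut_rider]
      split_ifs with hi
      · simp only [pairFlow, Finset.sum_boole, Finset.filter_filter, sub_eq_zero, Nat.cast_inj]
        congr 1
        ext p
        have := @hP.subset p
        simp only [Finset.mem_filter]
        tauto
      · rw [Finset.sum_eq_zero, sub_zero]
        intro p hp
        simp only [Finset.mem_filter] at hp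
        exact absurd ((mem_riders hI).2 ⟨p.1, hp.1⟩) (hp.2 ▸ hi)

theorem IsPairMatching.value_pairFlow (hI : I.IsRPC1) {P : Finset (Fin I.k × Fin I.l)}
    (hP : IsPairMatching P) : I.network.value (pairFlow P) = P.card := by
  rw [FlowNetwork.value]
  change I.network.netOut _ .source = _
  rw [netOut_source, Finset.card_eq_sum_card_fiberwise (f := Prod.fst) (t := I.drivers)
    (fun p hp => (mem_drivers hI).2 ⟨p.2, hP.subset hp⟩), Nat.cast_sum]
  simp only [pairFlow]

theorem IsPairMatching.flowCost_pairFlow {P : Finset (Fin I.k × Fin I.l)}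
    (hP : IsPairMatching P) :
    I.network.flowCost (pairFlow P) = - (I.weight (pairEdges P) : ℝ) := by
  rw [flowCost_network, weight_pairEdges, Int.cast_sum]
  simp only [pairFlow, mul_ite, mul_one, mul_zero]
  rw [← Finset.sum_filter]
  congr 2
  ext p
  have := @hP.subset p
  simp only [Finset.mem_filter]
  tauto

/-- Whichever minimum cost flows are chosen, the answer of ExactNF is correct. -/
theorem IsRPC1.isCorrectAnswer_exactNF (hI : I.IsRPC1) (c : ℤ)
    {f : ℕ → Option (Node I.k I.l × Node I.k I.l → ℝ)} (hf : I.IsMinCostFlowFamily f) :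
    I.IsCorrectAnswer c (I.exactNF c f) := by
  classical
  have h01 : ∀ {y g}, I.network.IsIntegralMinCostFlow y g → ∀ e, g e = 0 ∨ g e = 1 :=
    fun hg => hg.isFlow.eq_zero_or_one (fun _ _ => rfl) hg.integral
  -- The flow induced by a matching that meets the target competes with `f_y` for `y` the size of
  -- the matching, so this `y` is among the candidates of step 3.
  have found : ∀ M', I.IsMatching M' → M'.Nonempty → c ≤ I.weight M' →
      M'.card ∈ Finset.Icc 1 I.nMin ∧ ∃ g, f M'.card = some g ∧ I.network.supportCost g ≤ -c := by
    intro M' hM' hne hc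
    obtain ⟨P, hP, rfl⟩ := hM'.exists_pairs hI
    have h1 : 1 ≤ (pairEdges P).card := hne.card_pos
    have h2 : (pairEdges P).card ≤ I.nMin := by
      rw [card_pairEdges]; exact hP.card_le_nMin hI
    refine ⟨Finset.mem_Icc.2 ⟨h1, h2⟩, ?_⟩
    have hy := hf _ h1 h2
    have hval : I.network.value (pairFlow P) = (pairEdges P).card := by
      rw [hP.value_pairFlow hI, card_pairEdges]
    cases hfy : f (pairEdges P).card with
    | none =>
      rw [hfy] at hy
      exact absurd ⟨_, hP.isFlow_pairFlow hI, hval⟩ hy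
    | some g =>
      rw [hfy] at hy
      refine ⟨g, rfl, ?_⟩
      have := hy.le_cost _ (hP.isFlow_pairFlow hI) hval
      rw [hP.flowCost_pairFlow, ← FlowNetwork.supportCost_eq_flowCost _ (h01 hy)] at this
      have h' : I.network.supportCost g ≤ - I.weight (pairEdges P) := by exact_mod_cast this
      omega
  simp only [exactNF]
  split_ifs with h
  · have hmax := Finset.max'_mem _ h
    obtain ⟨hY, g, hg, hcost⟩ := Finset.mem_filter.1 hmax
    set Y := Finset.max' _ h with hYdef
    have hfY := hf Y (Finset.mem_Icc.1 hY).1 (Finset.mem_Icc.1 hY).2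
    rw [hg] at hfY ⊢
    have hcard : (I.flowEdges g).card = Y := by
      rw [flowEdges_eq, card_pairEdges]
      have := card_flowPairs hI hfY.isFlow (h01 hfY)
      rw [hfY.value_eq] at this
      exact_mod_cast this
    refine ⟨Finset.card_pos.1 (hcard ▸ (Finset.mem_Icc.1 hY).1), ?_, ?_, ?_⟩
    · rw [flowEdges_eq]
      exact (isPairMatching_flowPairs hI hfY.isFlow (h01 hfY)).isMatching
    · rw [weight_flowEdges (h01 hfY)]
      omega
    · intro M' hM' hc
      rw [hcard]
      -- Candidates start at `y = 1`, so the empty matching, which meets a target `c ≤ 0`, is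
      -- compared separately.
      rcases M'.eq_empty_or_nonempty with rfl | hne
      · simp
      · exact Finset.le_max' _ _ (Finset.mem_filter.2 (found M' hM' hne hc))
  · have hno : ¬ ∃ M', I.IsMatching M' ∧ M'.Nonempty ∧ c ≤ I.weight M' := by
      rintro ⟨M', hM', hne, hc⟩
      exact h ⟨_, Finset.mem_filter.2 (found M' hM' hne hc)⟩
    refine ⟨hno, ?_⟩
    rintro hc ⟨M', hM', hw⟩
    rcases M'.eq_empty_or_nonempty with rfl | hne
    · simp [weight] at hw
      omega
    · exact hno ⟨M', hM', hne, hw⟩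

end Instance

namespace RAM

/-! ### Reasoning about programs -/

@[simp] theorem State.setReg_reg (σ : State) (r : ℕ) (v : ℤ) (s : ℕ) :
    (σ.setReg r v).reg s = if s = r then v else σ.reg s := by
  simp [State.setReg, Function.update_apply]

@[simp] theorem State.setReg_mem (σ : State) (r : ℕ) (v : ℤ) : (σ.setReg r v).mem = σ.mem := rfl

@[simp] theorem State.setMem_reg (σ : State) (a : ℕ) (i v : ℤ) : (σ.setMem a i v).reg = σ.reg := rfl

@[simp] theorem State.setMem_mem (σ : State) (a : ℕ) (i v : ℤ) (b : ℕ) (j : ℤ) :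
    (σ.setMem a i v).mem b j = if b = a ∧ j = i then v else σ.mem b j := by
  by_cases h : b = a
  · subst h
    simp [State.setMem, Function.update_apply]
  · simp [State.setMem, h]

theorem State.setMem_mem_of_ne (σ : State) {a b : ℕ} (i v : ℤ) (h : b ≠ a) :
    (σ.setMem a i v).mem b = σ.mem b := by
  simp [State.setMem, h]

/-- Whether the program has an assignment to the register `r`. -/
def Prog.writesReg (r : ℕ) : Prog → Bool
  | .skip => false
  | .assign s _ => s == r
  | .store _ _ _ => false
  | .seq P Q => P.writesReg r || Q.writesReg r
  | .ite _ P Q => P.writesReg r || Q.writesReg r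
  | .loop _ P => P.writesReg r

/-- Whether the program stores into the array `a`. -/
def Prog.writesMem (a : ℕ) : Prog → Bool
  | .skip => false
  | .assign _ _ => false
  | .store b _ _ => b == a
  | .seq P Q => P.writesMem a || Q.writesMem a
  | .ite _ P Q => P.writesMem a || Q.writesMem a
  | .loop _ P => P.writesMem a

/-- `τ` agrees with `σ` in all registers and arrays that `P` does not write to. -/
structure Frame (P : Prog) (σ τ : State) : Prop where
  reg : ∀ r, P.writesReg r = false → τ.reg r = σ.reg r
  mem : ∀ a, P.writesMem a = false → τ.mem a = σ.mem a

theorem Frame.refl (P : Prog) (σ : State) : Frame P σ σ := ⟨fun _ _ => rfl, fun _ _ => rfl⟩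

theorem Frame.trans {P : Prog} {σ τ ρ : State} (h : Frame P σ τ) (h' : Frame P τ ρ) :
    Frame P σ ρ :=
  ⟨fun r hr => (h'.reg r hr).trans (h.reg r hr), fun a ha => (h'.mem a ha).trans (h.mem a ha)⟩

theorem Frame.mono {P Q : Prog} {σ τ : State} (h : Frame P σ τ)
    (hr : ∀ r, Q.writesReg r = false → P.writesReg r = false)
    (ha : ∀ a, Q.writesMem a = false → P.writesMem a = false) : Frame Q σ τ :=
  ⟨fun r h' => h.reg r (hr r h'), fun a h' => h.mem a (ha a h')⟩

/-- What a program can change is decided by its text alone. For concrete programs the side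
conditions `writesReg` and `writesMem` compute, so later uses discharge them by `rfl`. -/
theorem Exec.frame {P : Prog} {σ τ : State} {t : ℕ} (h : Exec P σ τ t) : Frame P σ τ := by
  induction h with
  | skip σ => exact .refl _ _
  | assign r x σ =>
    refine ⟨fun s hs => ?_, fun _ _ => rfl⟩
    simp only [Prog.writesReg, beq_eq_false_iff_ne] at hs
    simp [hs.symm]
  | store a i x σ =>
    refine ⟨fun _ _ => rfl, fun b hb => ?_⟩
    simp only [Prog.writesMem, beq_eq_false_iff_ne] at hb
    exact State.setMem_mem_of_ne _ _ _ hb.symm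
  | seq _ _ ih₁ ih₂ =>
    exact (ih₁.mono (by simp +contextual [Prog.writesReg])
      (by simp +contextual [Prog.writesMem])).trans
      (ih₂.mono (by simp +contextual [Prog.writesReg]) (by simp +contextual [Prog.writesMem]))
  | ite_true _ _ ih =>
    exact ih.mono (by simp +contextual [Prog.writesReg]) (by simp +contextual [Prog.writesMem])
  | ite_false _ _ ih =>
    exact ih.mono (by simp +contextual [Prog.writesReg]) (by simp +contextual [Prog.writesMem])
  | loop_done _ => exact .refl _ _
  | loop_step _ _ _ ih₁ ih₂ => exact Frame.trans ⟨ih₁.reg, ih₁.mem⟩ ih₂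

/-- Started in `σ`, the program halts after at most `T` steps in a state with the property `Q`. -/
def Runs (P : Prog) (σ : State) (T : ℕ) (Q : State → Prop) : Prop :=
  ∃ τ t, Exec P σ τ t ∧ t ≤ T ∧ Q τ

theorem Runs.mono {P : Prog} {σ : State} {T T' : ℕ} {Q Q' : State → Prop} (h : Runs P σ T Q)
    (hT : T ≤ T') (hQ : ∀ τ, Frame P σ τ → Q τ → Q' τ) : Runs P σ T' Q' := by
  obtain ⟨τ, t, hE, ht, hq⟩ := h
  exact ⟨τ, t, hE, ht.trans hT, hQ τ hE.frame hq⟩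

theorem Runs.seq {P Q : Prog} {σ : State} {T U : ℕ} {R S : State → Prop} (hP : Runs P σ T R)
    (hQ : ∀ τ, Frame P σ τ → R τ → Runs Q τ U S) : Runs (.seq P Q) σ (T + U) S := by
  obtain ⟨τ, t, hE, ht, hr⟩ := hP
  obtain ⟨ρ, u, hE', hu, hs⟩ := hQ τ hE.frame hr
  exact ⟨ρ, t + u, hE.seq hE', Nat.add_le_add ht hu, hs⟩

theorem Runs.assign {r : ℕ} {x : Expr} {σ : State} {Q : State → Prop}
    (h : Q (σ.setReg r (x.eval σ))) : Runs (.assign r x) σ (x.steps + 1) Q :=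
  ⟨_, _, .assign r x σ, le_rfl, h⟩

theorem Runs.ite {b : Cond} {P P' : Prog} {σ : State} {T : ℕ} {Q : State → Prop}
    (h : b.holds σ → Runs P σ T Q) (h' : ¬ b.holds σ → Runs P' σ T Q) :
    Runs (.ite b P P') σ (b.steps + T + 1) Q := by
  by_cases hb : b.holds σ
  · obtain ⟨τ, t, hE, ht, hq⟩ := h hb
    exact ⟨τ, _, .ite_true hb hE, by omega, hq⟩
  · obtain ⟨τ, t, hE, ht, hq⟩ := h' hb
    exact ⟨τ, _, .ite_false hb hE, by omega, hq⟩

/-- The loop rule, with an invariant whose argument decreases and bounds the number of rounds. -/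
theorem Runs.loop {b : Cond} {P : Prog} {σ : State} (Inv : ℕ → State → Prop) (k B : ℕ)
    (h0 : Inv k σ)
    (hs : ∀ k τ, Frame P σ τ → Inv k τ → b.holds τ → Runs P τ B fun ρ => ∃ k' < k, Inv k' ρ) :
    Runs (.loop b P) σ (k * (b.steps + B + 1) + (b.steps + 1))
      fun τ => (∃ k', Inv k' τ) ∧ ¬ b.holds τ := by
  -- A round may lower the measure by more than one, so the induction runs over an upper bound `n`
  -- of `k` instead of `k` itself.
  suffices H : ∀ n k τ, Frame P σ τ → Inv k τ → k ≤ n →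
      Runs (.loop b P) τ (n * (b.steps + B + 1) + (b.steps + 1))
        fun τ => (∃ k', Inv k' τ) ∧ ¬ b.holds τ from
    H _ k σ (.refl _ _) h0 le_rfl
  intro n
  induction n with
  | zero =>
    intro k τ hF hI hn
    refine ⟨τ, _, .loop_done fun hb => ?_, by omega, ⟨k, hI⟩, fun hb => ?_⟩ <;>
    · obtain ⟨ρ, t, -, -, k', hk', -⟩ := hs k τ hF hI hb
      omega
  | succ n ih =>
    intro k τ hF hI hn
    by_cases hb : b.holds τ
    · obtain ⟨ρ, t, hE, ht, k', hk', hIρ⟩ := hs k τ hF hI hb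
      obtain ⟨ξ, u, hE', hu, hξ⟩ := ih k' ρ (hF.trans hE.frame) hIρ (by omega)
      refine ⟨ξ, _, .loop_step hb hE hE', ?_, hξ⟩
      rw [Nat.succ_mul]
      omega
    · exact ⟨τ, _, .loop_done hb, by omega, ⟨k, hI⟩, hb⟩

/-! ### Symbolic execution of loop-free programs, and counting loops -/

/-- Whether a program has no loops. -/
def Prog.loopFree : Prog → Bool
  | .seq P Q => P.loopFree && Q.loopFree
  | .ite _ P Q => P.loopFree && Q.loopFree
  | .loop _ _ => false
  | _ => true

open Classical in
/-- The state in which a program without loops halts. -/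
noncomputable def Prog.out : Prog → State → State
  | .skip, σ => σ
  | .assign r x, σ => σ.setReg r (x.eval σ)
  | .store a i x, σ => σ.setMem a (i.eval σ) (x.eval σ)
  | .seq P Q, σ => Q.out (P.out σ)
  | .ite b P Q, σ => if b.holds σ then P.out σ else Q.out σ
  | .loop _ _, σ => σ

/-- A bound for the number of steps of a program without loops. -/
def Prog.bound : Prog → ℕ
  | .skip => 1
  | .assign _ x => x.steps + 1
  | .store _ i x => i.steps + x.steps + 1
  | .seq P Q => P.bound + Q.bound
  | .ite b P Q => b.steps + (P.bound + Q.bound) + 1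
  | .loop _ _ => 0

/-- Without loops the final state is a function of the initial one, so a postcondition becomes a
statement about `Prog.out` that can be simplified directly. Adding both branches in `Prog.bound`
overestimates but is enough. -/
theorem Prog.runs_out {P : Prog} (hP : P.loopFree = true) (σ : State) :
    ∃ t ≤ P.bound, Exec P σ (P.out σ) t := by
  classical
  induction P generalizing σ with
  | skip => exact ⟨1, le_rfl, .skip σ⟩
  | assign r x => exact ⟨_, le_rfl, .assign r x σ⟩
  | store a i x => exact ⟨_, le_rfl, .store a i x σ⟩
  | seq P Q ihP ihQ =>
    simp only [Prog.loopFree, Bool.and_eq_true] at hP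
    obtain ⟨t, ht, h⟩ := ihP hP.1 σ
    obtain ⟨u, hu, h'⟩ := ihQ hP.2 (P.out σ)
    exact ⟨t + u, Nat.add_le_add ht hu, h.seq h'⟩
  | ite b P Q ihP ihQ =>
    simp only [Prog.loopFree, Bool.and_eq_true] at hP
    simp only [Prog.out, Prog.bound]
    split_ifs with hb
    · obtain ⟨t, ht, h⟩ := ihP hP.1 σ
      exact ⟨_, by omega, .ite_true hb h⟩
    · obtain ⟨t, ht, h⟩ := ihQ hP.2 σ
      exact ⟨_, by omega, .ite_false hb h⟩
  | loop b P => simp [Prog.loopFree] at hP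

theorem Runs.loopFree {P : Prog} {σ : State} {T : ℕ} {Q : State → Prop} (hP : P.loopFree = true)
    (hT : P.bound ≤ T) (h : Q (P.out σ)) : Runs P σ T Q := by
  obtain ⟨t, ht, hE⟩ := Prog.runs_out hP σ
  exact ⟨_, t, hE, ht.trans hT, h⟩

/-- The counting loop: `P` is run with register `i` taking the values `0, …, n - 1`, where `n` is
the value of register `r`. -/
def Prog.count (i r : ℕ) (P : Prog) : Prog :=
  .seq (.assign i (.const 0))
    (.loop (.not (.le (.reg r) (.reg i))) (.seq P (.assign i (.add (.reg i) (.const 1)))))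

/-- The invariant is required after the increment, in the state where register `i` already holds `j
+ 1`. The body may not write to `i` or `r`, so the counter and its limit are known in every round.
-/
theorem Runs.count {i r : ℕ} {P : Prog} {σ : State} (n B : ℕ) (Inv : ℕ → State → Prop)
    (hn : σ.reg r = n) (hPi : P.writesReg i = false) (hPr : P.writesReg r = false) (hir : i ≠ r)
    (h0 : Inv 0 (σ.setReg i 0))
    (hs : ∀ j < n, ∀ τ, Frame (Prog.count i r P) σ τ → τ.reg i = j → Inv j τ →
      Runs P τ B fun ρ => Inv (j + 1) (ρ.setReg i ((j + 1 : ℕ) : ℤ))) :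
    Runs (Prog.count i r P) σ (n * (B + 9) + 7) (Inv n) := by
  have hinit : Frame (Prog.count i r P) σ (σ.setReg i 0) :=
    ⟨fun s hs' => by
      simp only [Prog.count, Prog.writesReg, Bool.or_eq_false_iff, beq_eq_false_iff_ne] at hs'
      simp [hs'.1.symm], fun _ _ => rfl⟩
  -- The guard takes 4 steps, the body with the increment `B + 4`, and the loop one more per round.
  have key : Runs (Prog.count i r P) σ
      ((Expr.const 0).steps + 1 + (n * (5 - 1 + (B + 4) + 1) + (4 + 1)))
      fun τ => (∃ j ≤ n, τ.reg i = j ∧ Inv j τ ∧ Frame (Prog.count i r P) σ τ) ∧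
        ¬ (Cond.not (.le (.reg r) (.reg i))).holds τ := by
    refine Runs.seq (R := fun τ => τ = σ.setReg i 0) (.assign rfl) ?_
    rintro _ - rfl
    refine (Runs.loop
      (fun k τ => ∃ j ≤ n, k = n - j ∧ τ.reg i = j ∧ Inv j τ ∧ Frame (Prog.count i r P) σ τ)
      n (B + 4) ⟨0, by omega, by omega, by simp, h0, hinit⟩ ?_).mono ?_
      fun τ _ ⟨⟨_, j, hj, _, h⟩, hb⟩ => ⟨⟨j, hj, h⟩, hb⟩
    · rintro k τ hF ⟨j, hj, rfl, hij, hI, hFr⟩ hb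
      have hrn : τ.reg r = n := by
        rw [hFr.reg r]
        · exact hn
        · simp [Prog.count, Prog.writesReg, hPr, hir]
      simp only [Cond.holds, Expr.eval, hij, hrn] at hb
      have hjn : j < n := by omega
      refine Runs.seq ((hs j hjn τ hFr hij hI).mono le_rfl
        (Q' := fun ρ => Inv (j + 1) (ρ.setReg i ((j + 1 : ℕ) : ℤ)) ∧ Frame P τ ρ)
        fun ρ h h' => ⟨h', h⟩) (U := 4) ?_
      rintro ρ - ⟨hρ, hFρ⟩
      refine .assign ?_
      have hρi : ρ.reg i = j := (hFρ.reg i hPi).trans hij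
      have hval : (Expr.add (.reg i) (.const 1)).eval ρ = ((j + 1 : ℕ) : ℤ) := by
        simp [Expr.eval, hρi]
      rw [hval]
      refine ⟨n - (j + 1), by omega, j + 1, hjn, rfl, by simp, hρ,
        hFr.trans ⟨fun s hs' => ?_, fun a ha => ?_⟩⟩
      · simp only [Prog.count, Prog.writesReg, Bool.or_eq_false_iff, beq_eq_false_iff_ne] at hs'
        simp [hs'.1.symm, hFρ.reg s hs'.2.1]
      · simp only [Prog.count, Prog.writesMem, Bool.or_false, Bool.false_or] at ha
        exact hFρ.mem a ha
    · simp [Cond.steps, Expr.steps]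
  refine key.mono ?_ ?_
  · simp only [Expr.steps]
    have : 5 - 1 + (B + 4) + 1 = B + 9 := by omega
    rw [this]
    omega
  · rintro τ - ⟨⟨j, hj, hij, hI, hFr⟩, hb⟩
    have hrn : τ.reg r = n := by
      rw [hFr.reg r]
      · exact hn
      · simp [Prog.count, Prog.writesReg, hPr, hir]
    simp only [Cond.holds, Expr.eval, hij, hrn, not_not] at hb
    have : j = n := by omega
    exact this ▸ hI

end RAM

/-! ### Residual arcs and potentials

The vertices are integers here, and the `m` edges are given by arrays. All capacities are one. -/

structure ArcList where
  m : ℕ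
  tail : ℕ → ℤ
  head : ℕ → ℤ
  cost : ℕ → ℤ

namespace ArcList

variable (G : ArcList)

/-- The tail of the residual arc of the edge `a`, for the flow `x` with values `0` and `1`. -/
def src (x : ℕ → ℤ) (a : ℕ) : ℤ := if x a = 0 then G.tail a else G.head a

/-- The head of the residual arc of the edge `a`. -/
def dst (x : ℕ → ℤ) (a : ℕ) : ℤ := if x a = 0 then G.head a else G.tail a

/-- The cost of the residual arc of the edge `a`. -/
def resCost (x : ℕ → ℤ) (a : ℕ) : ℤ := if x a = 0 then G.cost a else - G.cost a

/-- The reduced cost of the residual arc of the edge `a`, for the potential `φ`. -/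
def redCost (x : ℕ → ℤ) (φ : ℤ → ℤ) (a : ℕ) : ℤ :=
  G.resCost x a + φ (G.src x a) - φ (G.dst x a)

/-- No residual arc has a negative reduced cost. -/
def Feasible (x : ℕ → ℤ) (φ : ℤ → ℤ) : Prop :=
  ∀ a < G.m, (x a = 0 ∨ x a = 1) ∧ 0 ≤ G.redCost x φ a

/-- Flow leaving `v` minus flow entering `v`. -/
def balance (x : ℕ → ℤ) (v : ℤ) : ℤ :=
  ∑ a ∈ Finset.range G.m,
    x a * ((if G.tail a = v then 1 else 0) - (if G.head a = v then 1 else 0))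

/-- The vertex `0`, and the ends of the edges. -/
def nodes : Finset ℤ :=
  insert 0 ((Finset.range G.m).image G.tail ∪ (Finset.range G.m).image G.head)

variable {G}

theorem card_nodes_le : G.nodes.card ≤ 2 * G.m + 1 := by
  refine (Finset.card_insert_le _ _).trans (Nat.succ_le_succ ((Finset.card_union_le _ _).trans ?_))
  have h1 := Finset.card_image_le (s := Finset.range G.m) (f := G.tail)
  have h2 := Finset.card_image_le (s := Finset.range G.m) (f := G.head)
  rw [Finset.card_range] at h1 h2
  omega

theorem dst_mem_nodes (x : ℕ → ℤ) {a : ℕ} (ha : a < G.m) : G.dst x a ∈ G.nodes := by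
  have ha' := Finset.mem_range.2 ha
  simp only [nodes, Finset.mem_insert, Finset.mem_union]
  rw [dst]
  split_ifs
  · exact .inr (.inr (Finset.mem_image_of_mem _ ha'))
  · exact .inr (.inl (Finset.mem_image_of_mem _ ha'))

section Flip

variable {x x' : ℕ → ℤ} {b : ℕ}

/-- Sending one unit of flow along the residual arc of `b` preserves feasibility if the arc has
reduced cost zero. -/
theorem Feasible.flip {φ : ℤ → ℤ} (h : G.Feasible x φ) (hb : b < G.m)
    (h0 : G.redCost x φ b = 0) (hx : ∀ a, x' a = if a = b then 1 - x b else x a) :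
    G.Feasible x' φ := by
  intro a ha
  by_cases hab : a = b
  · subst hab
    have hxa : x' a = 1 - x a := by rw [hx, if_pos rfl]
    -- On the flipped edge the residual arc is reversed and its cost negated, so its reduced cost
    -- changes sign and stays zero.
    rcases (h a ha).1 with h1 | h1 <;>
    · simp only [redCost, resCost, src, dst, hxa, h1] at h0 ⊢
      norm_num at h0 ⊢
      linarith
  · have hxa : x' a = x a := by rw [hx, if_neg hab]
    have := h a ha
    simp only [redCost, resCost, src, dst, hxa] at this ⊢
    exact this

theorem balance_flip (hb : b < G.m) (h01 : x b = 0 ∨ x b = 1)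
    (hx : ∀ a, x' a = if a = b then 1 - x b else x a) (v : ℤ) :
    G.balance x' v = G.balance x v +
      ((if G.src x b = v then 1 else 0) - (if G.dst x b = v then 1 else 0)) := by
  rw [← sub_eq_iff_eq_add', balance, balance, ← Finset.sum_sub_distrib,
    Finset.sum_eq_single b (fun a _ hab => by rw [hx, if_neg hab, sub_self])
      (fun h => absurd (Finset.mem_range.2 hb) h), hx, if_pos rfl]
  rcases h01 with h | h <;> simp [src, dst, h]

end Flip

/-! ### Growing the set of reached vertices -/

/-- The vertices `Q 0, …, Q (n - 1)` have been reached from `0` along residual arcs of reduced cost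
zero; the arc `par (Q q)` leads to `Q q` from a vertex reached before. -/
structure Reached (G : ArcList) (x : ℕ → ℤ) (φ : ℤ → ℤ) (n : ℕ) (Q par : ℤ → ℤ) : Prop where
  pos : 0 < n
  zero : Q 0 = 0
  inj : ∀ p < n, ∀ q < n, Q (p : ℤ) = Q (q : ℤ) → p = q
  arc : ∀ q < n, 0 < q → ∃ a < G.m, par (Q q) = a ∧ G.dst x a = Q q ∧
    (∃ p < q, G.src x a = Q (p : ℤ)) ∧ G.redCost x φ a = 0

/-- `v` is one of the first `n` entries of `Q`. -/
def InQueue (n : ℕ) (Q : ℤ → ℤ) (v : ℤ) : Prop := ∃ q < n, Q (q : ℤ) = v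

variable {x : ℕ → ℤ} {φ : ℤ → ℤ} {n : ℕ} {Q par : ℤ → ℤ}

theorem Reached.mem_nodes (h : G.Reached x φ n Q par) {q : ℕ} (hq : q < n) : Q q ∈ G.nodes := by
  rcases Nat.eq_zero_or_pos q with rfl | h0
  · simp only [Nat.cast_zero, h.zero, nodes, Finset.mem_insert, true_or]
  · obtain ⟨a, ha, -, hd, -⟩ := h.arc q hq h0
    exact hd ▸ dst_mem_nodes x ha

/-- The queue lists distinct vertices, each being `0` or an end of an edge. This bounds the rounds
of a search in terms of the number of edges. -/
theorem Reached.le_nodes (h : G.Reached x φ n Q par) : n ≤ 2 * G.m + 1 := by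
  refine le_trans ?_ G.card_nodes_le
  have := Finset.card_le_card_of_injOn (s := Finset.range n) (t := G.nodes) (fun q : ℕ => Q q)
    (fun q hq => h.mem_nodes (Finset.mem_range.1 hq))
    (fun p hp q hq hpq => h.inj p (Finset.mem_range.1 hp) q (Finset.mem_range.1 hq) hpq)
  simpa using this

theorem Reached.start (G : ArcList) (x : ℕ → ℤ) (φ : ℤ → ℤ) (par : ℤ → ℤ) (hQ : Q 0 = 0) :
    G.Reached x φ 1 Q par where
  pos := one_pos
  zero := hQ
  inj := by omega
  arc := by omega

open Classical in
/-- The potential after lowering it by `δ` on the reached vertices. -/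
noncomputable def lower (φ : ℤ → ℤ) (n : ℕ) (Q : ℤ → ℤ) (δ : ℤ) (v : ℤ) : ℤ :=
  if InQueue n Q v then φ v - δ else φ v

/-- The residual arc of `a` leaves the set of reached vertices. -/
def Leaves (G : ArcList) (x : ℕ → ℤ) (n : ℕ) (Q : ℤ → ℤ) (a : ℕ) : Prop :=
  InQueue n Q (G.src x a) ∧ ¬ InQueue n Q (G.dst x a)

/-- Only arcs crossing the boundary of the reached set change their reduced cost: entering arcs gain
`δ`, leaving arcs lose `δ` and can afford it by `hmin`. -/
theorem Feasible.lower (hf : G.Feasible x φ) {δ : ℤ} (hδ : 0 ≤ δ)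
    (hmin : ∀ a < G.m, G.Leaves x n Q a → δ ≤ G.redCost x φ a) :
    G.Feasible x (lower φ n Q δ) := by
  classical
  intro a ha
  refine ⟨(hf a ha).1, ?_⟩
  have h0 := (hf a ha).2
  have h1 := hmin a ha
  simp only [redCost, ArcList.lower, Leaves] at h0 h1 ⊢
  by_cases hs : InQueue n Q (G.src x a) <;> by_cases hd : InQueue n Q (G.dst x a) <;>
    simp only [hs, hd, if_true, if_false, not_true, not_false_iff, and_self, forall_const] at h1 ⊢
      <;> omega

/-- The vertex at the end of a leaving arc of least reduced cost is reached next. -/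
theorem Reached.extend (h : G.Reached x φ n Q par) {b : ℕ} (hb : b < G.m)
    (hl : G.Leaves x n Q b) {Q' par' : ℤ → ℤ}
    (hQ : ∀ q : ℕ, Q' q = if q = n then G.dst x b else Q q)
    (hpar : ∀ v, par' v = if v = G.dst x b then (b : ℤ) else par v) :
    G.Reached x (ArcList.lower φ n Q (G.redCost x φ b)) (n + 1) Q' par' := by
  classical
  have hlt : ∀ {q : ℕ}, q < n → Q' q = Q q := fun hq => by rw [hQ, if_neg hq.ne]
  have hnew : Q' (n : ℤ) = G.dst x b := by rw [hQ, if_pos rfl]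
  have hne : ∀ {q : ℕ}, q < n → Q q ≠ G.dst x b := fun hq e => hl.2 ⟨_, hq, e⟩
  refine ⟨n.succ_pos, ?_, ?_, ?_⟩
  · exact (hlt h.pos).trans h.zero
  · intro p hp q hq hpq
    rcases Nat.lt_succ_iff_lt_or_eq.1 hp with hp | rfl <;>
      rcases Nat.lt_succ_iff_lt_or_eq.1 hq with hq | rfl
    · rw [hlt hp, hlt hq] at hpq
      exact h.inj p hp q hq hpq
    · rw [hlt hp, hnew] at hpq
      exact absurd hpq (hne hp)
    · rw [hlt hq, hnew] at hpq
      exact absurd hpq.symm (hne hq)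
    · rfl
  · intro q hq h0
    rcases Nat.lt_succ_iff_lt_or_eq.1 hq with hq | rfl
    · obtain ⟨a, ha, hpa, hd, ⟨p, hp, hs⟩, hr⟩ := h.arc q hq h0
      refine ⟨a, ha, ?_, ?_, ⟨p, hp, ?_⟩, ?_⟩
      · rw [hlt hq, hpar, if_neg (hne hq), hpa]
      · rw [hlt hq, hd]
      · rw [hlt (hp.trans hq), hs]
      -- Both ends of an old tree arc are reached, so the two changes of potential cancel.
      · simp only [redCost, ArcList.lower] at hr ⊢
        rw [if_pos (show InQueue n Q (G.src x a) from ⟨p, hp.trans hq, hs.symm⟩),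
          if_pos (show InQueue n Q (G.dst x a) from ⟨q, hq, hd.symm⟩)]
        linarith
    · obtain ⟨p, hp, hs⟩ := hl.1
      refine ⟨b, hb, ?_, hnew.symm, ⟨p, hp, ?_⟩, ?_⟩
      · rw [hnew, hpar, if_pos rfl]
      · rw [hlt hp, hs]
      -- Only the tail of the new arc is lowered, by exactly the reduced cost of the arc, which
      -- thereby becomes zero.
      · simp only [redCost, ArcList.lower]
        rw [if_pos (show InQueue q Q (G.src x b) from ⟨p, hp, hs⟩), if_neg hl.2]
        ring

/-! ### Augmentation -/

/-- The state of the augmentation along the parent arcs, from `1` back to `0`: in `x'`, one unit of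
flow has been sent from `v` to `1`. -/
structure Augmenting (G : ArcList) (x : ℕ → ℤ) (φ : ℤ → ℤ) (Q par : ℤ → ℤ) (p : ℕ)
    (x' : ℕ → ℤ) (v : ℤ) : Prop where
  pos : v = Q p
  unchanged : ∀ q ≤ p, 0 < q → ∀ a : ℕ, par (Q q) = a → x' a = x a
  feasible : G.Feasible x' φ
  balance : ∀ w, G.balance x' w =
    G.balance x w + ((if v = w then 1 else 0) - (if (1 : ℤ) = w then 1 else 0))

theorem Augmenting.start (hf : G.Feasible x φ) {p : ℕ} (hp : Q p = 1) :
    G.Augmenting x φ Q par p x 1 where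
  pos := hp.symm
  unchanged := fun _ _ _ _ _ => rfl
  feasible := hf
  balance := by simp

/-- Reversing the parent arc moves the endpoint to an earlier queue position, which gives
termination; the balances telescope. Parent arcs of earlier queue entries are other edges, because
they lead to other vertices, so they still carry their original flow and have reduced cost zero when
their turn comes. -/
theorem Augmenting.step (h : G.Reached x φ n Q par) {p : ℕ} (hp : p < n) {x' : ℕ → ℤ} {v : ℤ}
    (hA : G.Augmenting x φ Q par p x' v) (hv : v ≠ 0) :
    ∃ a < G.m, par v = a ∧ (x' a = 0 ∨ x' a = 1) ∧
      ∀ x'', (∀ c, x'' c = if c = a then 1 - x' a else x' c) →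
        ∃ p' < p, G.Augmenting x φ Q par p' x'' (G.src x' a) := by
  have h0 : 0 < p := by
    rcases Nat.eq_zero_or_pos p with rfl | h0
    · exact absurd (hA.pos.trans h.zero) hv
    · exact h0
  obtain ⟨a, ha, hpa, hd, ⟨p', hp', hs⟩, hr⟩ := h.arc p hp h0
  have hxa : x' a = x a := hA.unchanged p le_rfl h0 a hpa
  have hsrc : G.src x' a = G.src x a := by simp only [src, hxa]
  have hdst : G.dst x' a = G.dst x a := by simp only [dst, hxa]
  refine ⟨a, ha, by rw [hA.pos, hpa], (hA.feasible a ha).1, fun x'' hx => ⟨p', hp', ?_, ?_, ?_, ?_⟩⟩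
  · rw [hsrc, hs]
  · intro q hq hq0 c hc
    rw [hx, if_neg, hA.unchanged q (by omega) hq0 c hc]
    rintro rfl
    obtain ⟨c', -, hpc, hdc, -⟩ := h.arc q (by omega) hq0
    have : c' = c := by rw [hc] at hpc; exact_mod_cast hpc.symm
    subst this
    have := h.inj p hp q (by omega) (hd.symm.trans hdc)
    omega
  · refine hA.feasible.flip ha ?_ hx
    rw [← hr]
    simp only [redCost, resCost, src, dst, hxa]
  · intro w
    rw [balance_flip ha (hA.feasible a ha).1 hx, hA.balance, hdst, hd, hA.pos]
    ring

/-! ### The certificates that the algorithm leaves behind -/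

/-- `x` is a flow of value `y` from `0` to `1`, and a potential shows that its cost is minimum. -/
def IsCertifiedFlow (G : ArcList) (y : ℤ) (x : ℕ → ℤ) : Prop :=
  (∃ φ, G.Feasible x φ) ∧
    ∀ v, G.balance x v = y * ((if (0 : ℤ) = v then 1 else 0) - (if (1 : ℤ) = v then 1 else 0))

/-- Only the values on the `m` edges matter. This lets a certificate follow the flow when it is
copied to another array. -/
theorem IsCertifiedFlow.congr {y : ℤ} {x x' : ℕ → ℤ} (h : G.IsCertifiedFlow y x)
    (hx : ∀ a < G.m, x' a = x a) : G.IsCertifiedFlow y x' := by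
  obtain ⟨⟨φ, hφ⟩, hb⟩ := h
  refine ⟨⟨φ, fun a ha => ?_⟩, fun v => ?_⟩
  · have := hφ a ha
    simp only [redCost, resCost, src, dst, hx a ha] at this ⊢
    exact this
  · rw [← hb]
    exact Finset.sum_congr rfl fun a ha => by rw [hx a (Finset.mem_range.1 ha)]

/-- A cut shows that there is no flow of value `y` from `0` to `1`. -/
def IsCutOff (G : ArcList) (y : ℤ) : Prop :=
  ∃ (S : Set ℤ) (x : ℕ → ℤ) (z : ℤ), (0 : ℤ) ∈ S ∧ (1 : ℤ) ∉ S ∧ z < y ∧ G.IsCertifiedFlow z x ∧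
    ∀ a < G.m, G.src x a ∈ S → G.dst x a ∈ S

end ArcList

/-! ### The program for the minimum cost flows -/

namespace FlowProgram

open RAM ArcList

/-- The arcs are in memory. -/
structure HasArcs (G : ArcList) (σ : State) : Prop where
  count : σ.reg 4 = G.m
  tail : ∀ a : ℕ, σ.mem 5 a = G.tail a
  head : ∀ a : ℕ, σ.mem 6 a = G.head a
  cost : ∀ a : ℕ, σ.mem 8 a = G.cost a

theorem HasArcs.of_frame {G : ArcList} {P : Prog} {σ τ : State} (h : HasArcs G σ)
    (hF : Frame P σ τ) (h4 : P.writesReg 4 = false) (h5 : P.writesMem 5 = false)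
    (h6 : P.writesMem 6 = false) (h8 : P.writesMem 8 = false) : HasArcs G τ where
  count := (hF.reg 4 h4).trans h.count
  tail a := (congrFun (hF.mem 5 h5) a).trans (h.tail a)
  head a := (congrFun (hF.mem 6 h6) a).trans (h.head a)
  cost a := (congrFun (hF.mem 8 h8) a).trans (h.cost a)

/-- Load the ends and the reduced cost of the residual arc of the edge `reg 12`. -/
def loadArc : Prog :=
  .seq (.ite (.eq (.load 20 (.reg 12)) (.const 0))
    (.seq (.assign 23 (.load 5 (.reg 12))) (.seq (.assign 24 (.load 6 (.reg 12)))
      (.assign 25 (.load 8 (.reg 12)))))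
    (.seq (.assign 23 (.load 6 (.reg 12))) (.seq (.assign 24 (.load 5 (.reg 12)))
      (.assign 25 (.sub (.const 0) (.load 8 (.reg 12)))))))
  (.assign 25 (.sub (.add (.reg 25) (.load 21 (.reg 23))) (.load 21 (.reg 24))))

/-- Compare the loaded arc with the best leaving arc found so far. -/
def compareArc : Prog :=
  .ite (.and (.and (.eq (.load 22 (.reg 23)) (.reg 11)) (.not (.eq (.load 22 (.reg 24)) (.reg 11))))
      (.not (.and (.le (.const 0) (.reg 13)) (.le (.reg 14) (.reg 25)))))
    (.seq (.assign 13 (.reg 12)) (.seq (.assign 14 (.reg 25)) (.assign 15 (.reg 24)))) .skip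

/-- Find a leaving arc of least reduced cost. -/
def scan : Prog := .seq (.assign 13 (.const (-1))) (.count 12 4 (.seq loadArc compareArc))

/-- The registers `13`, `14`, `15` describe the best leaving arc among the first `j` edges. -/
def Best (G : ArcList) (x : ℕ → ℤ) (φ : ℤ → ℤ) (n : ℕ) (Q : ℤ → ℤ) (j : ℕ) (σ : State) : Prop :=
  (σ.reg 13 = -1 ∧ ∀ a < j, ¬ G.Leaves x n Q a) ∨
    ∃ b < j, σ.reg 13 = b ∧ G.Leaves x n Q b ∧ σ.reg 14 = G.redCost x φ b ∧
      σ.reg 15 = G.dst x b ∧ ∀ a < j, G.Leaves x n Q a → G.redCost x φ b ≤ G.redCost x φ a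

/-- The memory during the search of phase `y`, with `n` reached vertices. -/
structure Searching (G : ArcList) (X : ℤ → ℤ) (y : ℤ) (n : ℕ) (σ : State) : Prop where
  arcs : HasArcs G σ
  flow : σ.mem 20 = X
  phase : σ.reg 11 = y
  size : σ.reg 16 = n
  feasible : G.Feasible (fun a => X a) (σ.mem 21)
  reached : G.Reached (fun a => X a) (σ.mem 21) n (σ.mem 24) (σ.mem 23)
  mark : ∀ v, σ.mem 22 v = y ↔ InQueue n (σ.mem 24) v
  mark_le : ∀ v, σ.mem 22 v ≤ y

theorem runs_scan {G : ArcList} {X : ℤ → ℤ} {y : ℤ} {n : ℕ} {σ : State}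
    (h : Searching G X y n σ) :
    Runs scan σ (G.m * 80 + 10) fun τ =>
      Best G (fun a => X a) (σ.mem 21) n (σ.mem 24) G.m τ ∧ Searching G X y n τ := by
  have key : Runs scan σ (2 + (G.m * (71 + 9) + 7))
      fun τ => Best G (fun a => X a) (σ.mem 21) n (σ.mem 24) G.m τ := by
    refine Runs.seq (R := fun τ => τ = σ.setReg 13 (-1)) (.assign rfl) ?_
    rintro _ - rfl
    refine Runs.count G.m 71 (fun j τ => Best G (fun a => X a) (σ.mem 21) n (σ.mem 24) j τ)
      (by simpa using h.arcs.count) rfl rfl (by decide) (.inl ⟨by simp, by omega⟩) ?_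
    intro j hj τ hF hi hI
    have ht : τ.mem 5 j = G.tail j := by rw [hF.mem 5 rfl]; exact h.arcs.tail j
    have hh : τ.mem 6 j = G.head j := by rw [hF.mem 6 rfl]; exact h.arcs.head j
    have hc : τ.mem 8 j = G.cost j := by rw [hF.mem 8 rfl]; exact h.arcs.cost j
    have hx : τ.mem 20 = X := (hF.mem 20 rfl).trans h.flow
    have hp : τ.mem 21 = σ.mem 21 := hF.mem 21 rfl
    have hm : ∀ v, τ.mem 22 v = y ↔ InQueue n (σ.mem 24) v := by
      rw [hF.mem 22 rfl]; exact h.mark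
    have hy : τ.reg 11 = y := by rw [hF.reg 11 rfl]; simpa using h.phase
    refine (Runs.seq (T := 36) (R := fun ρ => ρ.reg 23 = G.src (fun a => X a) j ∧
      ρ.reg 24 = G.dst (fun a => X a) j ∧ ρ.reg 25 = G.redCost (fun a => X a) (σ.mem 21) j)
      (.loopFree rfl (by decide) ?_) (U := 35) ?_).mono le_rfl fun _ _ h => h
    · simp only [loadArc, Prog.out, Cond.holds, Expr.eval, hi, hx]
      by_cases h0 : X j = 0
      · simp [h0, src, dst, redCost, resCost, ht, hh, hc, hp, hi]
      · simp [h0, src, dst, redCost, resCost, ht, hh, hc, hp, hi]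
    · rintro ρ hF' ⟨hs, hd, hr⟩
      have hm' : ∀ v, ρ.mem 22 v = y ↔ InQueue n (σ.mem 24) v := by
        rw [hF'.mem 22 rfl]; exact hm
      have hy' : ρ.reg 11 = y := (hF'.reg 11 rfl).trans hy
      have hi' : ρ.reg 12 = j := (hF'.reg 12 rfl).trans hi
      have hI' : Best G (fun a => X a) (σ.mem 21) n (σ.mem 24) j ρ := by
        simp only [Best, hF'.reg 13 rfl, hF'.reg 14 rfl, hF'.reg 15 rfl]
        exact hI
      -- A mark equal to the phase number means reached, so the test on the two marks recognizes
      -- leaving arcs.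
      have hbest : (ρ.mem 22 (ρ.reg 23) = ρ.reg 11 ∧ ¬ ρ.mem 22 (ρ.reg 24) = ρ.reg 11) ↔
          G.Leaves (fun a => X a) n (σ.mem 24) j := by rw [hy', hm', hm', hs, hd, Leaves]
      refine (Runs.ite (T := 8) (fun hb => .loopFree rfl (by decide) ?_)
        fun hb => .loopFree rfl (by decide) ?_).mono (by decide) fun _ _ h => h
      · simp only [Cond.holds, Expr.eval, hbest] at hb
        refine .inr ⟨j, j.lt_succ_self, by simp [Prog.out, Expr.eval, hi'], hb.1,
          by simp [Prog.out, Expr.eval, hr], by simp [Prog.out, Expr.eval, hd], fun a ha hla => ?_⟩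
        rcases Nat.lt_succ_iff_lt_or_eq.1 ha with ha | rfl
        · rcases hI' with ⟨-, h1⟩ | ⟨b, -, h1, -, h2, -, h3⟩
          · exact absurd hla (h1 a ha)
          · have := h3 a ha hla
            have h4 := hb.2
            rw [h1, h2, hr] at h4
            omega
        · exact le_rfl
      · simp only [Cond.holds, Expr.eval, hbest] at hb
        rcases hI' with ⟨h0, h1⟩ | ⟨b, hbj, h1, h2, h3, h4, h5⟩
        · refine .inl ⟨by simpa [Prog.out] using h0, fun a ha hla => ?_⟩
          rcases Nat.lt_succ_iff_lt_or_eq.1 ha with ha | rfl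
          · exact h1 a ha hla
          · refine hb ⟨hla, ?_⟩
            rw [h0]
            omega
        · refine .inr ⟨b, hbj.trans j.lt_succ_self, by simpa [Prog.out] using h1, h2,
            by simpa [Prog.out] using h3, by simpa [Prog.out] using h4, fun a ha hla => ?_⟩
          rcases Nat.lt_succ_iff_lt_or_eq.1 ha with ha | rfl
          · exact h5 a ha hla
          · by_contra hlt
            refine hb ⟨hla, ?_⟩
            rw [h1, h3, hr]
            omega
  refine key.mono (by omega) fun τ hF hτ => ⟨hτ, h.arcs.of_frame hF rfl rfl rfl rfl,
    (hF.mem 20 rfl).trans h.flow, (hF.reg 11 rfl).trans h.phase, (hF.reg 16 rfl).trans h.size,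
    ?_, ?_, ?_, ?_⟩
  · rw [hF.mem 21 rfl]; exact h.feasible
  · rw [hF.mem 21 rfl, hF.mem 23 rfl, hF.mem 24 rfl]; exact h.reached
  · rw [hF.mem 22 rfl, hF.mem 24 rfl]; exact h.mark
  · rw [hF.mem 22 rfl]; exact h.mark_le

/-- Lower the potential of all reached vertices by `reg 14`. -/
def lowerLoop : Prog :=
  .count 19 16 (.store 21 (.load 24 (.reg 19)) (.sub (.load 21 (.load 24 (.reg 19))) (.reg 14)))

/-- Distinctness of the queue entries guarantees that each reached vertex is lowered once and not
repeatedly. -/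
theorem runs_lowerLoop {σ : State} {n : ℕ} (hn : σ.reg 16 = n)
    (hinj : ∀ p < n, ∀ q < n, σ.mem 24 (p : ℤ) = σ.mem 24 (q : ℤ) → p = q) :
    Runs lowerLoop σ (n * 17 + 7)
      fun τ => τ.mem 21 = ArcList.lower (σ.mem 21) n (σ.mem 24) (σ.reg 14) := by
  classical
  refine (Runs.count n 8
    (fun j τ => ∀ v, τ.mem 21 v = ArcList.lower (σ.mem 21) j (σ.mem 24) (σ.reg 14) v)
    hn rfl rfl (by decide) (fun v => ?_) ?_).mono le_rfl fun _ _ h => funext h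
  · simp [ArcList.lower, InQueue]
  · intro j hj τ hF hi hI
    refine .loopFree rfl (by decide) ?_
    intro v
    have h24 : τ.mem 24 = σ.mem 24 := hF.mem 24 rfl
    have h14 : τ.reg 14 = σ.reg 14 := hF.reg 14 rfl
    have hsucc : InQueue (j + 1) (σ.mem 24) v ↔ InQueue j (σ.mem 24) v ∨ σ.mem 24 j = v := by
      constructor
      · rintro ⟨q, hq, rfl⟩
        rcases Nat.lt_succ_iff_lt_or_eq.1 hq with hq | rfl
        · exact .inl ⟨q, hq, rfl⟩
        · exact .inr rfl
      · rintro (⟨q, hq, h⟩ | h)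
        · exact ⟨q, hq.trans j.lt_succ_self, h⟩
        · exact ⟨j, j.lt_succ_self, h⟩
    simp only [Prog.out, Expr.eval, hi, State.setReg_mem, State.setMem_mem, true_and, h24, h14, hI]
    by_cases hv : v = σ.mem 24 j
    · subst hv
      have hnot : ¬ InQueue j (σ.mem 24) (σ.mem 24 j) := by
        rintro ⟨q, hq, h⟩
        exact hq.ne (hinj q (hq.trans hj) j hj h)
      rw [if_pos rfl, ArcList.lower, ArcList.lower, if_neg hnot, if_pos (hsucc.2 (.inr rfl))]
    · rw [if_neg hv, ArcList.lower, ArcList.lower]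
      simp only [hsucc, Ne.symm hv, or_false]

/-- Put the vertex that the best leaving arc leads to at the end of the queue. -/
def enqueue : Prog :=
  .seq (.store 24 (.reg 16) (.reg 15)) (.seq (.store 22 (.reg 15) (.reg 11))
    (.seq (.store 23 (.reg 15) (.reg 13)) (.assign 16 (.add (.reg 16) (.const 1)))))

/-- One round of the search: reach one more vertex, or stop. -/
def searchStep : Prog :=
  .seq scan (.ite (.eq (.reg 13) (.const (-1))) (.assign 18 (.const 0)) (.seq lowerLoop enqueue))

def search : Prog := .loop (.eq (.reg 18) (.const 1)) searchStep

/-- The invariant of the search; `k` bounds the number of rounds to come. -/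
def SearchInv (G : ArcList) (X : ℤ → ℤ) (y : ℤ) (k : ℕ) (σ : State) : Prop :=
  ∃ n, Searching G X y n σ ∧ ((σ.reg 18 = 1 ∧ k + n = 2 * G.m + 2) ∨
    (σ.reg 18 = 0 ∧ k = 0 ∧ ∀ a < G.m, ¬ G.Leaves (fun a => X a) n (σ.mem 24) a))

/-- Either no arc leaves and the search ends, or the scan supplies the leaving arc of least reduced
cost, for which `Feasible.lower` and `Reached.extend` apply together. -/
theorem runs_searchStep {G : ArcList} {X : ℤ → ℤ} {y : ℤ} {k : ℕ} {σ : State}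
    (h : SearchInv G X y k σ) (h18 : σ.reg 18 = 1) :
    Runs searchStep σ (G.m * 114 + 60) fun τ => ∃ k' < k, SearchInv G X y k' τ := by
  obtain ⟨n, hS, ⟨-, hk⟩ | ⟨h0, -⟩⟩ := h
  swap
  · omega
  have hn : n ≤ 2 * G.m + 1 := hS.reached.le_nodes
  refine (Runs.seq (runs_scan hS) (U := G.m * 34 + 50) ?_).mono (by omega) fun _ _ h => h
  rintro τ hF ⟨hbest, hSτ⟩
  rw [← hF.mem 21 rfl, ← hF.mem 24 rfl] at hbest
  have hone : τ.reg 18 = 1 := (hF.reg 18 rfl).trans h18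
  refine (Runs.ite (T := G.m * 34 + 46) (fun hb => ?_) fun hb => ?_).mono
    (by simp [Cond.steps, Expr.steps]; omega) fun _ _ h => h
  · simp only [Cond.holds, Expr.eval] at hb
    rcases hbest with ⟨-, hno⟩ | ⟨b, -, hb', -⟩
    swap
    · omega
    refine (Runs.assign (Q := fun τ => ∃ k' < k, SearchInv G X y k' τ) ?_).mono
      (by simp [Expr.steps]) fun _ _ h => h
    -- Stopping sets the measure to 0. This is a decrease, since `k + n = 2 * G.m + 2` and `n ≤ 2 *
    -- G.m + 1` make `k` positive.
    refine ⟨0, by omega, n, ⟨⟨?_, hSτ.arcs.tail, hSτ.arcs.head, hSτ.arcs.cost⟩, hSτ.flow, ?_, ?_,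
      hSτ.feasible, hSτ.reached, hSτ.mark, hSτ.mark_le⟩, .inr ⟨by simp [Expr.eval], rfl, hno⟩⟩
    · simpa using hSτ.arcs.count
    · simpa using hSτ.phase
    · simpa using hSτ.size
  · simp only [Cond.holds, Expr.eval] at hb
    rcases hbest with ⟨hb', -⟩ | ⟨b, hbm, h13, hl, h14, h15, hmin⟩
    · exact absurd hb' hb
    refine (Runs.seq (runs_lowerLoop hSτ.size hSτ.reached.inj) (U := 20) ?_).mono
      (by omega) fun _ _ h => h
    intro ρ hFρ hpot
    refine .loopFree rfl (by decide) ?_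
    have r13 : ρ.reg 13 = b := (hFρ.reg 13 rfl).trans h13
    have r15 : ρ.reg 15 = G.dst (fun a => X a) b := (hFρ.reg 15 rfl).trans h15
    have r11 : ρ.reg 11 = y := (hFρ.reg 11 rfl).trans hSτ.phase
    have r16 : ρ.reg 16 = n := (hFρ.reg 16 rfl).trans hSτ.size
    have r18 : ρ.reg 18 = 1 := (hFρ.reg 18 rfl).trans hone
    have m22 : ρ.mem 22 = τ.mem 22 := hFρ.mem 22 rfl
    have m23 : ρ.mem 23 = τ.mem 23 := hFρ.mem 23 rfl
    have m24 : ρ.mem 24 = τ.mem 24 := hFρ.mem 24 rfl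
    have hG := hSτ.arcs.of_frame hFρ rfl rfl rfl rfl
    have hfeas := hSτ.feasible.lower (hSτ.feasible b hbm).2 hmin
    rw [h14] at hpot
    have hne : ∀ q : ℕ, q < n → τ.mem 24 q ≠ G.dst (fun a => X a) b := fun q hq e => hl.2 ⟨q, hq, e⟩
    set ξ := enqueue.out ρ with hξ
    have hFξ : Frame enqueue ρ ξ := by
      obtain ⟨t, -, hE⟩ := Prog.runs_out (P := enqueue) rfl ρ
      exact hE.frame
    have e16 : ξ.reg 16 = (n + 1 : ℕ) := by
      simp [hξ, enqueue, Prog.out, Expr.eval, r16]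
    have e21 : ξ.mem 21 = ArcList.lower (τ.mem 21) n (τ.mem 24)
        (G.redCost (fun a => X a) (τ.mem 21) b) := (hFξ.mem 21 rfl).trans hpot
    have e22 : ∀ v, ξ.mem 22 v = if v = G.dst (fun a => X a) b then y else τ.mem 22 v := by
      intro v
      simp [hξ, enqueue, Prog.out, Expr.eval, r15, r11, m22]
    have e23 : ∀ v, ξ.mem 23 v = if v = G.dst (fun a => X a) b then (b : ℤ) else τ.mem 23 v := by
      intro v
      simp [hξ, enqueue, Prog.out, Expr.eval, r13, r15, m23]
    have e24 : ∀ q : ℕ, ξ.mem 24 q = if q = n then G.dst (fun a => X a) b else τ.mem 24 q := by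
      intro q
      simp [hξ, enqueue, Prog.out, Expr.eval, r16, r15, m24]
    have hR := hSτ.reached.extend hbm hl e24 e23
    refine ⟨k - 1, by omega, n + 1, ⟨hG.of_frame hFξ rfl rfl rfl rfl, ?_, ?_, e16, ?_, ?_, ?_, ?_⟩,
      .inl ⟨(hFξ.reg 18 rfl).trans r18, by omega⟩⟩
    · exact (hFξ.mem 20 rfl).trans ((hFρ.mem 20 rfl).trans hSτ.flow)
    · exact (hFξ.reg 11 rfl).trans r11
    · rw [e21]; exact hfeas
    · rw [e21]; exact hR
    · intro v
      rw [e22]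
      by_cases hv : v = G.dst (fun a => X a) b
      · rw [if_pos hv]
        exact ⟨fun _ => ⟨n, n.lt_succ_self, by rw [e24, if_pos rfl, hv]⟩, fun _ => rfl⟩
      · rw [if_neg hv, hSτ.mark]
        constructor
        · rintro ⟨q, hq, h⟩
          exact ⟨q, hq.trans n.lt_succ_self, by rw [e24, if_neg hq.ne, h]⟩
        · rintro ⟨q, hq, h⟩
          rw [e24] at h
          split_ifs at h with hqn
          · exact absurd h.symm hv
          · exact ⟨q, by omega, h⟩
    · intro v
      rw [e22]
      split_ifs
      · exact le_rfl
      · exact hSτ.mark_le v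

/-- The search does not stop at the sink but continues until no arc leaves the reached set. So its
result serves both outcomes: a path if the sink is reached, a closed set otherwise. -/
theorem runs_search {G : ArcList} {X : ℤ → ℤ} {y : ℤ} {σ : State}
    (h : Searching G X y 1 σ) (h18 : σ.reg 18 = 1) :
    Runs search σ ((2 * G.m + 1) * (G.m * 114 + 64) + 4) fun τ => ∃ n, Searching G X y n τ ∧
      ∀ a < G.m, ¬ G.Leaves (fun a => X a) n (τ.mem 24) a := by
  refine (Runs.loop (SearchInv G X y) (2 * G.m + 1) (G.m * 114 + 60)
    ⟨1, h, .inl ⟨h18, rfl⟩⟩ ?_).mono ?_ ?_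
  · intro k τ _ hI hb
    exact runs_searchStep hI hb
  · simp only [Cond.steps, Expr.steps]
    have : 1 + 1 + 1 + (G.m * 114 + 60) + 1 = G.m * 114 + 64 := by omega
    rw [this]
  · rintro τ - ⟨⟨k, n, hS, ⟨h1, -⟩ | ⟨-, -, hno⟩⟩, hb⟩
    · exact absurd h1 hb
    · exact ⟨n, hS, hno⟩

/-! ### Augmenting the flow in memory and saving it -/

/-- Reverse the parent arc of the vertex `reg 20` and go to its other end. -/
def traceStep : Prog :=
  .seq (.assign 21 (.load 23 (.reg 20))) (.ite (.eq (.load 20 (.reg 21)) (.const 0))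
    (.seq (.store 20 (.reg 21) (.const 1)) (.assign 20 (.load 5 (.reg 21))))
    (.seq (.store 20 (.reg 21) (.const 0)) (.assign 20 (.load 6 (.reg 21)))))

/-- Augment the flow along the parent arcs. -/
def trace : Prog := .seq (.assign 20 (.const 1)) (.loop (.not (.eq (.reg 20) (.const 0))) traceStep)

theorem runs_trace {G : ArcList} {X : ℤ → ℤ} {y : ℤ} {n : ℕ} {σ : State}
    (h : Searching G X y n σ) (h1 : σ.mem 22 1 = y) :
    Runs trace σ (G.m * 70 + 50) fun τ => G.Feasible (fun a => τ.mem 20 a) (σ.mem 21) ∧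
      ∀ w, G.balance (fun a => τ.mem 20 a) w =
        G.balance (fun a => X a) w +
          ((if (0 : ℤ) = w then 1 else 0) - (if (1 : ℤ) = w then 1 else 0)) := by
  obtain ⟨p, hp, hp1⟩ := (h.mark 1).1 h1
  have hn := h.reached.le_nodes
  refine (Runs.seq (R := fun τ => τ = σ.setReg 20 1) (.assign rfl)
    (U := G.m * 70 + 48) ?_).mono (by simp only [Expr.steps]; omega) fun _ _ h => h
  rintro _ - rfl
  -- The measure is the queue position of the current vertex, hence at most `2 * G.m`; with 35 steps
  -- per round this accounts for `G.m * 70`.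
  refine (Runs.loop (fun k τ => k < n ∧ G.Augmenting (fun a => X a) (σ.mem 21) (σ.mem 24)
    (σ.mem 23) k (fun a => τ.mem 20 a) (τ.reg 20)) p 30 ⟨hp, ?_⟩ ?_).mono ?_ ?_
  · simp only [State.setReg_mem, State.setReg_reg, if_true, h.flow]
    exact .start h.feasible hp1
  · rintro k τ hF ⟨hk, hA⟩ hb
    simp only [Cond.holds, Expr.eval] at hb
    have ht : ∀ a : ℕ, τ.mem 5 a = G.tail a := by rw [hF.mem 5 rfl]; exact h.arcs.tail
    have hh : ∀ a : ℕ, τ.mem 6 a = G.head a := by rw [hF.mem 6 rfl]; exact h.arcs.head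
    have m23 : τ.mem 23 = σ.mem 23 := hF.mem 23 rfl
    obtain ⟨a, -, hpa, h01, hstep⟩ := hA.step h.reached hk hb
    rw [← m23] at hpa
    have key : (∀ c : ℕ, (traceStep.out τ).mem 20 c = if c = a then 1 - τ.mem 20 a else τ.mem 20 c) ∧
        (traceStep.out τ).reg 20 = G.src (fun a => τ.mem 20 a) a := by
      rcases h01 with h0 | h0 <;>
        simp [traceStep, Prog.out, Cond.holds, Expr.eval, hpa, h0, src, ht, hh]
    refine .loopFree rfl (by decide) ?_
    obtain ⟨p', hp', hA'⟩ := hstep _ key.1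
    exact ⟨p', hp', hp'.trans hk, key.2 ▸ hA'⟩
  · simp only [Cond.steps, Expr.steps]
    omega
  · rintro τ - ⟨⟨k, -, hA⟩, hb⟩
    simp only [Cond.holds, Expr.eval, not_not] at hb
    exact ⟨hA.feasible, hb ▸ hA.balance⟩

/-- Append the current flow to the rows of array `10`. -/
def copyRow : Prog :=
  .count 12 4 (.seq (.store 10 (.reg 17) (.load 20 (.reg 12)))
    (.assign 17 (.add (.reg 17) (.const 1))))

/-- The last clause protects the rows saved in earlier phases, which lie below the write position
`B`. -/
theorem runs_copyRow {m : ℕ} {B : ℤ} {σ : State} (hm : σ.reg 4 = m) (hB : σ.reg 17 = B) :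
    Runs copyRow σ (m * 17 + 7) fun τ => τ.reg 17 = B + m ∧
      (∀ a < m, τ.mem 10 (B + (a : ℕ)) = σ.mem 20 a) ∧ ∀ z < B, τ.mem 10 z = σ.mem 10 z := by
  refine Runs.count m 8 (fun j τ => τ.reg 17 = B + j ∧
    (∀ a < j, τ.mem 10 (B + (a : ℕ)) = σ.mem 20 a) ∧ ∀ z < B, τ.mem 10 z = σ.mem 10 z)
    hm rfl rfl (by decide) ⟨by simpa using hB, by omega, fun _ _ => rfl⟩ ?_
  rintro j hj τ hF hi ⟨h17, hrow, hold⟩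
  refine .loopFree rfl (by decide) ⟨?_, fun a ha => ?_, fun z hz => ?_⟩
  · simp [Prog.out, Expr.eval, h17]
    ring
  · simp only [Prog.out, Expr.eval, State.setReg_mem, State.setMem_mem, h17, hi, true_and,
      add_right_inj, Nat.cast_inj, hF.mem 20 rfl]
    rcases Nat.lt_succ_iff_lt_or_eq.1 ha with ha | rfl
    · rw [if_neg ha.ne, hrow a ha]
    · rw [if_pos rfl]
  · simp only [Prog.out, Expr.eval, State.setReg_mem, State.setMem_mem, h17, true_and]
    rw [if_neg (by omega), hold z hz]

/-! ### The phases of successive augmentation -/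

/-- Start the search of phase `reg 11` at the vertex `0`. -/
def startSearch : Prog :=
  .seq (.store 22 (.const 0) (.reg 11)) (.seq (.store 24 (.const 0) (.const 0))
    (.seq (.assign 16 (.const 1)) (.assign 18 (.const 1))))

/-- From a minimum cost flow of value `reg 11 - 1`, find one of value `reg 11`, or stop. -/
def phase : Prog :=
  .seq startSearch (.seq search (.ite (.eq (.load 22 (.const 1)) (.reg 11))
    (.seq trace (.seq (.store 9 (.reg 11) (.const 1))
      (.seq copyRow (.assign 11 (.add (.reg 11) (.const 1))))))
    (.assign 11 (.add (.reg 10) (.const 1)))))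

/-- The flows of value `1, …, N` are in memory, or certificates that there are none. -/
def Solved (G : ArcList) (N : ℕ) (σ : State) : Prop :=
  ∀ y : ℕ, 1 ≤ y → y ≤ N →
    (σ.mem 9 y = 1 ∧ G.IsCertifiedFlow y fun a => σ.mem 10 (((y - 1) * G.m + a : ℕ) : ℤ)) ∨
      (σ.mem 9 y = 0 ∧ G.IsCutOff y)

/-- The flows of value `1, …, y` are in memory, and the last of them is the current flow. -/
structure Progress (G : ArcList) (y : ℕ) (σ : State) : Prop where
  arcs : HasArcs G σ
  phase : σ.reg 11 = (y + 1 : ℕ)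
  row : σ.reg 17 = (y * G.m : ℕ)
  feasible : G.Feasible (fun a => σ.mem 20 a) (σ.mem 21)
  balance : ∀ v, G.balance (fun a => σ.mem 20 a) v =
    y * ((if (0 : ℤ) = v then 1 else 0) - (if (1 : ℤ) = v then 1 else 0))
  mark_le : ∀ v, σ.mem 22 v ≤ y
  flag : ∀ z : ℕ, y < z → σ.mem 9 z = 0
  solved : Solved G y σ

/-- One closed set settles all remaining values: the current flow of value `y` saturates the cut, so
nothing above `y` is possible. The flags above `y` are still zero and already report this. -/
theorem Progress.cutOff {G : ArcList} {y N : ℕ} {σ : State} (h : Progress G y σ)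
    {S : Set ℤ} (h0 : (0 : ℤ) ∈ S) (h1 : (1 : ℤ) ∉ S)
    (hS : ∀ a < G.m, G.src (fun a => σ.mem 20 a) a ∈ S → G.dst (fun a => σ.mem 20 a) a ∈ S) :
    Solved G N σ := by
  intro z hz _
  by_cases hzy : z ≤ y
  · exact h.solved z hz hzy
  · exact .inr ⟨h.flag z (by omega), S, fun a => σ.mem 20 a, y, h0, h1, by omega,
      ⟨⟨_, h.feasible⟩, h.balance⟩, hS⟩

/-- Marks of earlier phases are at most `y`, so with the new phase number `y + 1` only the source
counts as reached. The marks need not be cleared. -/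
theorem Progress.runs_startSearch {G : ArcList} {y : ℕ} {σ : State} (h : Progress G y σ) :
    Runs startSearch σ 20 fun τ => Searching G (σ.mem 20) (y + 1 : ℕ) 1 τ ∧ τ.reg 18 = 1 := by
  refine .loopFree rfl (by decide) ?_
  have hF : Frame startSearch σ (startSearch.out σ) := by
    obtain ⟨t, -, hE⟩ := Prog.runs_out (P := startSearch) rfl σ
    exact hE.frame
  set τ := startSearch.out σ with hτ
  have e24 : τ.mem 24 0 = 0 := by simp [hτ, startSearch, Prog.out, Expr.eval]
  have e22 : ∀ v, τ.mem 22 v = if v = 0 then ((y + 1 : ℕ) : ℤ) else σ.mem 22 v := by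
    intro v
    simp [hτ, startSearch, Prog.out, Expr.eval, h.phase]
  refine ⟨⟨h.arcs.of_frame hF rfl rfl rfl rfl, hF.mem 20 rfl, (hF.reg 11 rfl).trans h.phase,
    ?_, ?_, ?_, fun v => ?_, fun v => ?_⟩, ?_⟩
  · simp [hτ, startSearch, Prog.out, Expr.eval]
  · rw [hF.mem 21 rfl]
    exact h.feasible
  · exact .start _ _ _ _ e24
  · rw [e22]
    have := h.mark_le v
    have hq : InQueue 1 (τ.mem 24) v ↔ v = 0 := by
      constructor
      · rintro ⟨q, hq, rfl⟩
        have : q = 0 := by omega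
        subst this
        exact e24
      · rintro rfl
        exact ⟨0, one_pos, e24⟩
    rw [hq]
    split_ifs with hv <;> simp [hv]
    omega
  · rw [e22]
    have := h.mark_le v
    split_ifs
    · exact le_rfl
    · push_cast
      omega
  · simp [hτ, startSearch, Prog.out, Expr.eval]

/-- A bound for the number of steps of a phase. -/
def phaseBound (m : ℕ) : ℕ := (2 * m + 1) * (m * 114 + 64) + m * 87 + 100

/-- If the sink is marked, tracing back yields a certified flow of value `y + 1`. If not, the marked
vertices form a cut, and register `11` is pushed beyond `N` to end the outer loop. -/
theorem Progress.runs_phase {G : ArcList} {y N : ℕ} {σ : State} (h : Progress G y σ)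
    (h10 : σ.reg 10 = N) :
    Runs FlowProgram.phase σ (phaseBound G.m) fun τ =>
      Progress G (y + 1) τ ∨ (Solved G N τ ∧ τ.reg 11 = N + 1) := by
  refine (Runs.seq h.runs_startSearch (U := (2 * G.m + 1) * (G.m * 114 + 64) + 4 + (G.m * 87 + 76))
    ?_).mono (by simp only [phaseBound]; omega) fun _ _ h => h
  rintro τ hF ⟨hS, h18⟩
  refine Runs.seq (runs_search hS h18) ?_
  rintro ρ hFρ ⟨n, hSρ, hclosed⟩
  have hFσ : ∀ a, startSearch.writesMem a = false → search.writesMem a = false →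
      ρ.mem a = σ.mem a := fun a h1 h2 => (hFρ.mem a h2).trans (hF.mem a h1)
  have m9 := hFσ 9 rfl rfl
  have m10 := hFσ 10 rfl rfl
  have m20 := hFσ 20 rfl rfl
  have r17 : ρ.reg 17 = (y * G.m : ℕ) := ((hFρ.reg 17 rfl).trans (hF.reg 17 rfl)).trans h.row
  refine (Runs.ite (T := G.m * 87 + 70) (fun hb => ?_) fun hb => ?_).mono
    (by simp only [Cond.steps, Expr.steps]; omega) fun _ _ h => h
  · simp only [Cond.holds, Expr.eval, hSρ.phase] at hb
    refine (Runs.seq (runs_trace hSρ hb) (U := G.m * 17 + 20) ?_).mono (by omega) fun _ _ h => h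
    rintro ξ hFξ ⟨hfeas, hbal⟩
    refine (Runs.seq (R := fun ζ => (∀ z : ℕ, ζ.mem 9 z = if z = y + 1 then 1 else ξ.mem 9 z))
      (T := 3) (.loopFree rfl (by decide) ?_) (U := G.m * 17 + 16) ?_).mono (by omega)
        fun _ _ h => h
    · intro z
      have : ξ.reg 11 = (y + 1 : ℕ) := (hFξ.reg 11 rfl).trans hSρ.phase
      simp only [Prog.out, Expr.eval, this, State.setMem_mem, true_and, Nat.cast_inj]
    · intro ζ hFζ hflag
      have hGζ := (hSρ.arcs.of_frame hFξ rfl rfl rfl rfl).of_frame hFζ rfl rfl rfl rfl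
      refine (Runs.seq (runs_copyRow (B := (y * G.m : ℕ)) hGζ.count
        (((hFζ.reg 17 rfl).trans (hFξ.reg 17 rfl)).trans r17)) (U := 8) ?_).mono
          (by omega) fun _ _ h => h
      rintro θ hFθ ⟨h17, hrow, hold⟩
      refine .loopFree rfl (by decide) (.inl ?_)
      have hGθ := hGζ.of_frame hFθ rfl rfl rfl rfl
      have m20θ : θ.mem 20 = ξ.mem 20 := (hFθ.mem 20 rfl).trans (hFζ.mem 20 rfl)
      have m21θ : θ.mem 21 = ρ.mem 21 :=
        ((hFθ.mem 21 rfl).trans (hFζ.mem 21 rfl)).trans (hFξ.mem 21 rfl)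
      have m22θ : θ.mem 22 = ρ.mem 22 :=
        ((hFθ.mem 22 rfl).trans (hFζ.mem 22 rfl)).trans (hFξ.mem 22 rfl)
      have m9θ : ∀ z : ℕ, θ.mem 9 z = if z = y + 1 then 1 else σ.mem 9 z := by
        intro z
        rw [hFθ.mem 9 rfl, hflag, hFξ.mem 9 rfl, m9]
      have m10θ : ∀ z < ((y * G.m : ℕ) : ℤ), θ.mem 10 z = σ.mem 10 z := by
        intro z hz
        rw [hold z hz, hFζ.mem 10 rfl, hFξ.mem 10 rfl, m10]
      have r11θ : θ.reg 11 = (y + 1 : ℕ) :=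
        ((hFθ.reg 11 rfl).trans (hFζ.reg 11 rfl)).trans ((hFξ.reg 11 rfl).trans hSρ.phase)
      have hbal' : ∀ v, G.balance (fun a => ξ.mem 20 a) v =
          ((y + 1 : ℕ) : ℤ) * ((if (0 : ℤ) = v then 1 else 0) - (if (1 : ℤ) = v then 1 else 0)) := by
        intro v
        rw [hbal, h.balance, Nat.cast_succ]
        ring
      refine ⟨⟨?_, hGθ.tail, hGθ.head, hGθ.cost⟩, ?_, ?_, ?_, ?_, ?_, ?_, ?_⟩
      · simpa [Prog.out] using hGθ.count
      · simp [Prog.out, Expr.eval, r11θ]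
      · simp [Prog.out, h17]
        ring
      · simpa only [Prog.out, State.setReg_mem, m20θ, m21θ] using hfeas
      · simpa only [Prog.out, State.setReg_mem, m20θ] using hbal'
      · simpa only [Prog.out, State.setReg_mem, m22θ] using hSρ.mark_le
      · intro z hz
        simp only [Prog.out, State.setReg_mem, m9θ]
        rw [if_neg (by omega), h.flag z (by omega)]
      · intro z hz hzy
        simp only [Prog.out, State.setReg_mem, m9θ]
        rcases Nat.lt_or_eq_of_le hzy with hlt | rfl
        · rw [if_neg hlt.ne]
          refine (h.solved z hz (by omega)).imp (fun ⟨h9, ⟨φ, hφ⟩, hb'⟩ => ⟨h9, ?_⟩) id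
          have hag : ∀ a < G.m, θ.mem 10 (((z - 1) * G.m + a : ℕ) : ℤ) =
              σ.mem 10 (((z - 1) * G.m + a : ℕ) : ℤ) := by
            intro a ha
            refine m10θ _ ?_
            -- Row `z` occupies the cells from `(z - 1) * m` to `z * m - 1`. For `z ≤ y` they all
            -- lie below `y * m`, where the new row begins.
            have h1 : (z - 1 + 1) * G.m ≤ y * G.m := Nat.mul_le_mul_right _ (by omega)
            rw [Nat.add_mul, one_mul] at h1
            exact_mod_cast (by omega : (z - 1) * G.m + a < y * G.m)
          exact IsCertifiedFlow.congr ⟨⟨φ, hφ⟩, hb'⟩ hag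
        · rw [if_pos rfl]
          refine .inl ⟨rfl, IsCertifiedFlow.congr ⟨⟨_, hfeas⟩, hbal'⟩ fun a ha => ?_⟩
          have := hrow a ha
          rw [hFζ.mem 20 rfl] at this
          rw [← this]
          push_cast
          simp
  · simp only [Cond.holds, Expr.eval, hSρ.phase] at hb
    refine .loopFree rfl ?_ (.inr ⟨?_, ?_⟩)
    · simp only [Prog.bound, Expr.steps]
      omega
    · have hsol : Solved G N σ := by
        -- The cut consists of the marked vertices; that it misses the sink is the failed test `hb`.
        refine h.cutOff (S := {v | ρ.mem 22 v = (y + 1 : ℕ)}) ?_ hb ?_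
        · exact (hSρ.mark 0).2 ⟨0, hSρ.reached.pos, hSρ.reached.zero⟩
        · intro a ha hs
          by_contra hd
          exact hclosed a ha ⟨(hSρ.mark _).1 hs, fun h' => hd ((hSρ.mark _).2 h')⟩
      simpa only [Solved, Prog.out, State.setReg_mem, m9, m10] using hsol
    · have : ρ.reg 10 = N := ((hFρ.reg 10 rfl).trans (hF.reg 10 rfl)).trans h10
      simp [Prog.out, Expr.eval, this]

def phases : Prog := .loop (.le (.reg 11) (.reg 10)) phase

/-- The measure is the number of values still to be treated; it jumps to 0 when a cut has been
found. -/
theorem runs_phases {G : ArcList} {N : ℕ} {σ : State} (h : Progress G 0 σ) (h10 : σ.reg 10 = N) :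
    Runs phases σ (N * (phaseBound G.m + 4) + 4) (Solved G N) := by
  refine (Runs.loop (fun k τ => (∃ y, Progress G y τ ∧ k + y = N) ∨
    (k = 0 ∧ Solved G N τ ∧ τ.reg 11 = N + 1)) N (phaseBound G.m) (.inl ⟨0, h, rfl⟩) ?_).mono ?_ ?_
  · rintro k τ hF hI hb
    have r10 : τ.reg 10 = N := (hF.reg 10 rfl).trans h10
    simp only [Cond.holds, Expr.eval, r10] at hb
    rcases hI with ⟨y, hy, hk⟩ | ⟨-, -, h11⟩
    · rw [hy.phase] at hb
      refine (hy.runs_phase r10).mono le_rfl fun ρ _ hρ => ?_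
      rcases hρ with hρ | hρ
      · exact ⟨k - 1, by omega, .inl ⟨y + 1, hρ, by omega⟩⟩
      · exact ⟨0, by omega, .inr ⟨rfl, hρ⟩⟩
    · omega
  · simp only [Cond.steps, Expr.steps]
    have : 1 + 1 + 1 + phaseBound G.m + 1 = phaseBound G.m + 4 := by omega
    rw [this]
  · rintro τ hF ⟨⟨k, ⟨y, hy, hk⟩ | ⟨-, hS, -⟩⟩, hb⟩
    · have r10 : τ.reg 10 = N := (hF.reg 10 rfl).trans h10
      simp only [Cond.holds, Expr.eval, r10, hy.phase] at hb
      have : y = N := by omega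
      exact this ▸ hy.solved
    · exact hS

/-! ### The initial potential, and the complete program for step 2 -/

/-- A network with layers: arcs of cost zero from the source `0` to vertices above `1`, arcs from
there to vertices below `1`, and arcs of cost zero from vertices below `1` to other such vertices. -/
def Layered (G : ArcList) : Prop :=
  ∀ a < G.m, G.head a ≠ 0 ∧ ((1 < G.head a ∧ G.tail a = 0 ∧ G.cost a = 0) ∨
    (1 < G.tail a ∧ G.head a ≤ 1) ∨
    (G.head a ≤ 1 ∧ G.cost a = 0 ∧ G.tail a ≤ 1 ∧ ∃ b < G.m, G.head b = G.tail a))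

/-- Register `10` becomes the minimum of the registers `0` and `1`. -/
def setMin : Prog := .ite (.le (.reg 0) (.reg 1)) (.assign 10 (.reg 0)) (.assign 10 (.reg 1))

theorem runs_setMin {σ : State} {d r : ℕ} (h0 : σ.reg 0 = d) (h1 : σ.reg 1 = r) :
    Runs setMin σ 8 fun τ => τ.reg 10 = (min d r : ℕ) := by
  refine (Runs.ite (T := 2) (fun hb => .loopFree rfl (by decide) ?_)
    fun hb => .loopFree rfl (by decide) ?_).mono (by decide) fun _ _ h => h <;>
  · simp only [Cond.holds, Expr.eval, h0, h1] at hb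
    simp only [Prog.out, Expr.eval, State.setReg_reg, if_true, h0, h1, Nat.cast_inj]
    omega

/-- Register `22` becomes the a lower bound of all costs. -/
def minCost : Prog :=
  .seq (.assign 22 (.const 0)) (.count 12 4
    (.ite (.le (.reg 22) (.load 8 (.reg 12))) .skip (.assign 22 (.load 8 (.reg 12)))))

theorem runs_minCost {G : ArcList} {σ : State} (h : HasArcs G σ) :
    Runs minCost σ (G.m * 30 + 10) fun τ => ∀ a < G.m, τ.reg 22 ≤ G.cost a := by
  refine (Runs.seq (R := fun τ => τ = σ.setReg 22 0) (.assign rfl)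
    (U := G.m * (21 + 9) + 7) ?_).mono (by simp only [Expr.steps]; omega) fun _ _ h => h
  rintro _ - rfl
  refine Runs.count G.m 21 (fun j τ => ∀ a < j, τ.reg 22 ≤ G.cost a)
    (by simpa using h.count) rfl rfl (by decide) (by simp) ?_
  intro j hj τ hF hi hle
  have hc : τ.mem 8 j = G.cost j := by rw [hF.mem 8 rfl]; exact h.cost j
  refine (Runs.ite (T := 4) (fun hb => .loopFree rfl (by decide) ?_)
    fun hb => .loopFree rfl (by decide) ?_).mono (by decide) fun _ _ h => h
  · simp only [Cond.holds, Expr.eval, hi, hc] at hb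
    intro a ha
    rcases Nat.lt_succ_iff_lt_or_eq.1 ha with ha | rfl
    · simpa [Prog.out] using hle a ha
    · simpa [Prog.out] using hb
  · simp only [Cond.holds, Expr.eval, hi, hc] at hb
    intro a ha
    rcases Nat.lt_succ_iff_lt_or_eq.1 ha with ha | rfl
    · have := hle a ha
      simp [Prog.out, Expr.eval, hi, hc]
      omega
    · simp [Prog.out, Expr.eval, hi, hc]

/-- The potential becomes the least cost at all heads of arcs that are at most `1`. -/
def initPotential : Prog :=
  .count 12 4 (.ite (.le (.load 6 (.reg 12)) (.const 1))
    (.store 21 (.load 6 (.reg 12)) (.reg 22)) .skip)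

theorem runs_initPotential {G : ArcList} {σ : State} (h : HasArcs G σ) (h21 : ∀ v, σ.mem 21 v = 0) :
    Runs initPotential σ (G.m * 30 + 7) fun τ =>
      (∀ v, (1 < v ∨ ∀ a < G.m, G.head a ≠ v) → τ.mem 21 v = 0) ∧
        ∀ a < G.m, G.head a ≤ 1 → τ.mem 21 (G.head a) = σ.reg 22 := by
  refine Runs.count G.m 21 (fun j τ =>
      (∀ v, (1 < v ∨ ∀ a < G.m, G.head a ≠ v) → τ.mem 21 v = 0) ∧
        ∀ a < j, G.head a ≤ 1 → τ.mem 21 (G.head a) = σ.reg 22)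
    h.count rfl rfl (by decide) ⟨fun v _ => by simpa using h21 v, by omega⟩ ?_
  rintro j hj τ hF hi ⟨h0, hle⟩
  have hh : τ.mem 6 j = G.head j := by rw [hF.mem 6 rfl]; exact h.head j
  have hM : τ.reg 22 = σ.reg 22 := hF.reg 22 rfl
  refine (Runs.ite (T := 4) (fun hb => .loopFree rfl (by decide) ?_)
    fun hb => .loopFree rfl (by decide) ?_).mono (by decide) fun _ _ h => h
  · simp only [Cond.holds, Expr.eval, hi, hh] at hb
    simp only [Prog.out, Expr.eval, hi, hh, hM, State.setReg_mem, State.setMem_mem, true_and]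
    refine ⟨fun v hv => ?_, fun a ha hle1 => ?_⟩
    · rw [if_neg, h0 v hv]
      rintro rfl
      rcases hv with hv | hv
      · omega
      · exact hv j hj rfl
    · split_ifs with he
      · rfl
      · rcases Nat.lt_succ_iff_lt_or_eq.1 ha with ha | rfl
        · exact hle a ha hle1
        · exact absurd rfl he
  · simp only [Cond.holds, Expr.eval, hi, hh] at hb
    refine ⟨h0, fun a ha hle1 => ?_⟩
    rcases Nat.lt_succ_iff_lt_or_eq.1 ha with ha | rfl
    · exact hle a ha hle1
    · exact absurd hle1 hb

/-- The layers make shortest path computations unnecessary at the start. The potential is 0 at the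
source and the vertices above 1, and a common lower bound `c` of the costs at the heads that are at
most 1. Middle arcs get reduced cost `cost - c ≥ 0`, all others get 0. An arc of the last layer
needs its tail to be the head of some arc, so that the potential there is `c` too. -/
theorem Layered.feasible_zero {G : ArcList} (hG : Layered G) {φ : ℤ → ℤ} {c : ℤ}
    (hle : ∀ a < G.m, c ≤ G.cost a) (h0 : ∀ v, (1 < v ∨ ∀ a < G.m, G.head a ≠ v) → φ v = 0)
    (h1 : ∀ a < G.m, G.head a ≤ 1 → φ (G.head a) = c) : G.Feasible (fun _ => 0) φ := by
  intro a ha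
  refine ⟨.inl rfl, ?_⟩
  simp only [redCost, resCost, src, dst, if_true]
  have hca := hle a ha
  rcases (hG a ha).2 with ⟨hh, ht, h⟩ | ⟨ht, hh⟩ | ⟨hh, h, ht, b, hb, hbt⟩
  · rw [h0 _ (.inl hh), ht, h0 0 (.inr fun b hb => (hG b hb).1), h]
    simp
  · rw [h0 _ (.inl ht), h1 a ha hh]
    omega
  · rw [← hbt, h1 b hb (hbt ▸ ht), h1 a ha hh, h]
    omega

/-- The program for the minimum cost flows. -/
def flows : Prog :=
  .seq setMin (.seq minCost (.seq initPotential
    (.seq (.seq (.assign 11 (.const 1)) (.assign 17 (.const 0))) phases)))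

/-- A bound for the number of steps of the program `flows`. -/
def flowsBound (m N : ℕ) : ℕ := N * (phaseBound m + 4) + m * 60 + 40

/-- The zeros required by `hz` are initial data: no flow found yet, the zero flow, the zero
potential and no marks. -/
theorem runs_flows {G : ArcList} {σ : State} {d r : ℕ} (hG : Layered G) (h : HasArcs G σ)
    (hd : σ.reg 0 = d) (hr : σ.reg 1 = r)
    (hz : ∀ a ∈ [9, 20, 21, 22], ∀ v, σ.mem a v = 0) :
    Runs flows σ (flowsBound G.m (min d r)) (Solved G (min d r)) := by
  refine (Runs.seq (runs_setMin hd hr) (U := G.m * 30 + 10 + (G.m * 30 + 7 +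
    (4 + (min d r * (phaseBound G.m + 4) + 4)))) ?_).mono
      (by simp only [flowsBound]; omega) fun _ _ h => h
  intro τ₁ hF₁ h10
  have hA₁ := h.of_frame hF₁ rfl rfl rfl rfl
  refine Runs.seq (runs_minCost hA₁) ?_
  intro τ₂ hF₂ hM
  have hA₂ := hA₁.of_frame hF₂ rfl rfl rfl rfl
  refine Runs.seq (runs_initPotential hA₂ ?_) ?_
  · intro v
    rw [hF₂.mem 21 rfl, hF₁.mem 21 rfl, hz 21 (by simp)]
  rintro τ₃ hF₃ ⟨hp0, hp1⟩
  have hA₃ := hA₂.of_frame hF₃ rfl rfl rfl rfl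
  have hmem : ∀ a ∈ [9, 20, 22], ∀ v, τ₃.mem a v = 0 := by
    intro a ha v
    simp only [List.mem_cons, List.not_mem_nil, or_false] at ha
    rcases ha with rfl | rfl | rfl
    · rw [hF₃.mem 9 rfl, hF₂.mem 9 rfl, hF₁.mem 9 rfl, hz 9 (by simp)]
    · rw [hF₃.mem 20 rfl, hF₂.mem 20 rfl, hF₁.mem 20 rfl, hz 20 (by simp)]
    · rw [hF₃.mem 22 rfl, hF₂.mem 22 rfl, hF₁.mem 22 rfl, hz 22 (by simp)]
  have hx : (fun a : ℕ => τ₃.mem 20 a) = fun _ => 0 := funext fun a => hmem 20 (by simp) a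
  refine Runs.seq (R := fun τ => Progress G 0 τ ∧ τ.reg 10 = (min d r : ℕ))
    (.loopFree rfl (by decide) ⟨⟨⟨?_, hA₃.tail, hA₃.head, hA₃.cost⟩, ?_, ?_, ?_, ?_, ?_, ?_, ?_⟩, ?_⟩)
    fun τ _ hτ => runs_phases hτ.1 hτ.2
  · simpa [Prog.out] using hA₃.count
  · simp [Prog.out, Expr.eval]
  · simp [Prog.out, Expr.eval]
  · simp only [Prog.out, State.setReg_mem]
    rw [hx]
    exact hG.feasible_zero hM hp0 hp1
  · intro v
    simp only [Prog.out, State.setReg_mem]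
    rw [hx]
    simp [ArcList.balance]
  · intro v
    simp [Prog.out, hmem 22 (by simp)]
  · intro z _
    simp [Prog.out, hmem 9 (by simp)]
  · intro z hz1 hz2
    omega
  · have : τ₃.reg 10 = (min d r : ℕ) := (hF₃.reg 10 rfl).trans ((hF₂.reg 10 rfl).trans h10)
    simpa [Prog.out] using this

end FlowProgram

/-! ### The program that builds the network -/

namespace BuildProgram

open RAM

variable {I : Instance}

/-- The cells `a` of the arrays `5` to `8` describe the edge `e`. -/
def Describes (σ : State) (a : ℤ) (e : Node I.k I.l × Node I.k I.l) : Prop :=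
  σ.mem 5 a = e.1.code ∧ σ.mem 6 a = e.2.code ∧ σ.mem 7 a = 1 ∧ σ.mem 8 a = I.network.cost e

/-- The edges of `E` are in memory. -/
def Stored (E : List (Node I.k I.l × Node I.k I.l)) (σ : State) : Prop :=
  σ.reg 4 = E.length ∧ ∀ (a : ℕ) (h : a < E.length), Describes σ a E[a]

/-- Append an edge with tail `t`, head `h` and cost `c`. -/
def append (t h c : Expr) : Prog :=
  .seq (.assign 27 t) (.seq (.assign 28 h) (.seq (.assign 29 c)
    (.seq (.store 5 (.reg 4) (.reg 27)) (.seq (.store 6 (.reg 4) (.reg 28))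
      (.seq (.store 7 (.reg 4) (.const 1)) (.seq (.store 8 (.reg 4) (.reg 29))
        (.assign 4 (.add (.reg 4) (.const 1)))))))))

/-- The expressions do not depend on the registers `27` to `29` and compute the edge `e`. -/
def Computes (t h c : Expr) (σ : State) (e : Node I.k I.l × Node I.k I.l) : Prop :=
  t.eval σ = e.1.code ∧ (∀ v, h.eval (σ.setReg 27 v) = e.2.code) ∧
    ∀ v w, c.eval ((σ.setReg 27 v).setReg 28 w) = I.network.cost e

theorem Stored.append {E : List (Node I.k I.l × Node I.k I.l)} {σ : State} (hE : Stored E σ)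
    {t h c : Expr} {e : Node I.k I.l × Node I.k I.l} (he : Computes t h c σ e) :
    Stored (E ++ [e]) ((append t h c).out σ) := by
  obtain ⟨h4, hd⟩ := hE
  refine ⟨by simp [BuildProgram.append, Prog.out, Expr.eval, h4], fun a ha => ?_⟩
  rw [List.length_append, List.length_singleton] at ha
  rcases Nat.lt_succ_iff_lt_or_eq.1 ha with ha | rfl
  · rw [List.getElem_append_left ha]
    have := hd a ha
    simpa [Describes, BuildProgram.append, Prog.out, Expr.eval, h4, ha.ne] using this
  · rw [List.getElem_concat_length rfl]
    simp [Describes, BuildProgram.append, Prog.out, Expr.eval, h4, he.1, he.2.1, he.2.2]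

/-- Append an edge for every value of the register `26` below that of the register `r`. -/
def appendAll (r : ℕ) (t h c : Expr) : Prog := .count 26 r (append t h c)

theorem runs_appendAll {E L : List (Node I.k I.l × Node I.k I.l)} {σ : State} (hE : Stored E σ)
    {r : ℕ} (hr : r < 4) {t h c : Expr} (hL : σ.reg r = L.length)
    (hc : ∀ τ : State, ∀ j (hj : j < L.length), (∀ a < 5, τ.mem a = σ.mem a) → τ.reg 26 = j →
      Computes t h c τ L[j]) :
    Runs (appendAll r t h c) σ (L.length * ((append t h c).bound + 9) + 7) (Stored (E ++ L)) := by
  have hwr : (append t h c).writesReg r = false := by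
    interval_cases r <;> rfl
  refine (Runs.count L.length (append t h c).bound (fun j τ => Stored (E ++ L.take j) τ)
    hL rfl hwr (by omega) ?_ ?_).mono le_rfl ?_
  · simp only [List.take_zero, List.append_nil]
    exact ⟨by simpa using hE.1, hE.2⟩
  · intro j hj τ hF hi hS
    refine .loopFree rfl le_rfl ?_
    have := hS.append (hc τ j hj (fun a ha => hF.mem a ?_) hi)
    · rw [← List.take_concat_get' _ _ hj, ← List.append_assoc]
      exact ⟨by simpa using this.1, this.2⟩
    · simp only [Prog.count, append, Prog.writesMem, Bool.or_eq_false_iff, beq_eq_false_iff_ne,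
        and_true, true_and]
      omega
  · intro τ _ hτ
    rwa [List.take_length] at hτ

/-- Step 1 of ExactNF. -/
def build : Prog :=
  .seq (appendAll 0 (.const 0) (.add (.load 0 (.reg 26)) (.const 2)) (.const 0))
    (.seq (appendAll 2 (.add (.load 2 (.reg 26)) (.const 2))
      (.sub (.sub (.const 0) (.load 3 (.reg 26))) (.const 1)) (.sub (.const 0) (.load 4 (.reg 26))))
      (appendAll 1 (.sub (.sub (.const 0) (.load 1 (.reg 26))) (.const 1)) (.const 1) (.const 0)))

variable (L : I.Listing)

/-- The edges of the network, in the order in which they are built. -/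
def edgeList : List (Node I.k I.l × Node I.k I.l) :=
  L.driverList.map (fun i => (.source, .driver i)) ++
    L.pairList.map (fun p => (.driver p.1, .rider p.2)) ++
    L.riderList.map (fun j => (.rider j, .sink))

theorem length_edgeList :
    (edgeList L).length = L.driverList.length + L.pairList.length + L.riderList.length := by
  simp [edgeList, Nat.add_assoc]

theorem edgeList_toFinset : (edgeList L).toFinset = I.network.edges := by
  ext e
  simp only [edgeList, List.toFinset_append, Finset.mem_union, List.mem_toFinset, List.mem_map,
    Instance.mem_network_edges, ← L.drivers_eq, ← L.riders_eq, ← L.pairs_eq, or_assoc, eq_comm]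

theorem nodup_edgeList : (edgeList L).Nodup := by
  simp only [edgeList]
  refine List.Nodup.append (List.Nodup.append ?_ ?_ ?_) ?_ ?_
  · exact L.nodup_drivers.map fun i j h => by simpa using h
  · exact L.nodup_pairs.map fun p q h => by simpa [Prod.ext_iff] using h
  · intro e h h'
    obtain ⟨i, -, rfl⟩ := List.mem_map.1 h
    obtain ⟨p, -, hp⟩ := List.mem_map.1 h'
    simp at hp
  · exact L.nodup_riders.map fun i j h => by simpa using h
  · intro e h h'
    obtain ⟨j, -, rfl⟩ := List.mem_map.1 h'
    rcases List.mem_append.1 h with h | h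
    · obtain ⟨i, -, hp⟩ := List.mem_map.1 h
      simp at hp
    · obtain ⟨p, -, hp⟩ := List.mem_map.1 h
      simp at hp

theorem arrayOf_getElem {L : List ℤ} {a : ℕ} (h : a < L.length) :
    Instance.arrayOf L a = L[a] := by
  simp [Instance.arrayOf, h]

theorem getElem_flatMap_singleton {α β : Type*} (f : α → β) (l : List α) {j : ℕ}
    (h : j < (l.flatMap fun a => [f a]).length) (h' : j < l.length) :
    (l.flatMap fun a => [f a])[j] = f l[j] := by
  have : (l.flatMap fun a => [f a]) = l.map f := List.flatMap_pure_eq_map f l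
  simp only [this, List.getElem_map]

/-- A bound for the number of steps of the program `build`. -/
def buildBound (m : ℕ) : ℕ := m * 60 + 21

/-- Each of the three loops costs at most 60 steps per edge and 7 steps in addition, whence `m * 60
+ 21`. -/
theorem runs_build (c : ℤ) :
    Runs build (I.inputState L c) (buildBound (edgeList L).length) (Stored (edgeList L)) := by
  refine (Runs.seq (runs_appendAll (E := []) (σ := I.inputState L c)
    (L := L.driverList.map fun i => (.source, .driver i)) ⟨rfl, by simp⟩ (by decide) ?_ ?_)
    (U := L.pairList.length * 60 + 7 + (L.riderList.length * 60 + 7)) ?_).mono ?_ fun _ _ h => h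
  · simp [Instance.inputState]
  · intro τ j hj hm hi
    rw [List.length_map] at hj
    have h0 : τ.mem 0 j = ((L.driverList[j] : ℕ) : ℤ) := by
      rw [hm 0 (by decide)]
      exact (arrayOf_getElem (by simpa using hj)).trans (by simp [getElem_flatMap_singleton, hj])
    simp [Computes, Expr.eval, hi, h0, Node.code, Instance.network]
  · intro σ₁ hF₁ hS₁
    rw [List.nil_append] at hS₁
    refine (Runs.seq (runs_appendAll
      (L := L.pairList.map fun p => (.driver p.1, .rider p.2)) hS₁ (by decide) ?_ ?_)
      (U := L.riderList.length * 60 + 7) ?_).mono ?_ fun _ _ h => h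
    · rw [hF₁.reg 2 rfl]
      simp [Instance.inputState]
    · intro τ j hj hm hi
      rw [List.length_map] at hj
      have h2 : τ.mem 2 j = ((L.pairList[j].1 : ℕ) : ℤ) := by
        rw [hm 2 (by decide), hF₁.mem 2 rfl]
        exact (arrayOf_getElem (by simpa using hj)).trans (by simp)
      have h3 : τ.mem 3 j = ((L.pairList[j].2 : ℕ) : ℤ) := by
        rw [hm 3 (by decide), hF₁.mem 3 rfl]
        exact (arrayOf_getElem (by simpa using hj)).trans (by simp)
      have h4 : τ.mem 4 j = I.profit (L.pairList[j].1, {L.pairList[j].2}) := by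
        rw [hm 4 (by decide), hF₁.mem 4 rfl]
        exact (arrayOf_getElem (by simpa using hj)).trans (by simp)
      simp [Computes, Expr.eval, hi, h2, h3, h4, Node.code, Instance.network]
    · intro σ₂ hF₂ hS₂
      refine (runs_appendAll
        (L := L.riderList.map fun j => (.rider j, .sink)) hS₂ (by decide) ?_ ?_).mono ?_
        fun _ _ h => h
      · rw [hF₂.reg 1 rfl, hF₁.reg 1 rfl]
        simp [Instance.inputState]
      · intro τ j hj hm hi
        rw [List.length_map] at hj
        have h1 : τ.mem 1 j = ((L.riderList[j] : ℕ) : ℤ) := by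
          rw [hm 1 (by decide), hF₂.mem 1 rfl, hF₁.mem 1 rfl]
          exact (arrayOf_getElem (by simpa using hj)).trans (by simp [getElem_flatMap_singleton, hj])
        simp [Computes, Expr.eval, hi, h1, Node.code, Instance.network]
      · rw [List.length_map]
        exact Nat.add_le_add_right (Nat.mul_le_mul_left _ (by decide)) _
    · rw [List.length_map]
      exact Nat.add_le_add_right
        (Nat.add_le_add_right (Nat.mul_le_mul_left _ (by decide)) _) _
  · rw [List.length_map, buildBound, length_edgeList]
    have : (append (.const 0) (.add (.load 0 (.reg 26)) (.const 2)) (.const 0)).bound + 9 ≤ 60 := by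
      decide
    have := Nat.mul_le_mul_left L.driverList.length this
    omega

end BuildProgram

/-! ### The network as a list of arcs -/

/-- Source and sink have the codes 0 and 1, drivers lie above 1 and riders below 0, so the ranges
are disjoint. `Layered` uses the same ranges to tell the layers apart. -/
theorem Node.code_injective {k l : ℕ} : Function.Injective (Node.code : Node k l → ℤ) := by
  rintro (_ | _ | i | j) (_ | _ | i' | j') h <;> simp only [Node.code] at h <;>
    first
    | rfl
    | omega
    | (congr 1; ext; omega)

variable {I : Instance}

/-- The arcs of `G` are the edges of the network, in the order of the list `E`. -/
structure Represents (G : ArcList) (E : List (Node I.k I.l × Node I.k I.l)) : Prop where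
  nodup : E.Nodup
  edges_eq : E.toFinset = I.network.edges
  m_eq : G.m = E.length
  tail : ∀ a (h : a < E.length), G.tail a = (E[a]).1.code
  head : ∀ a (h : a < E.length), G.head a = (E[a]).2.code
  cost : ∀ a (h : a < E.length), G.cost a = I.network.cost E[a]

namespace Represents

variable {G : ArcList} {E : List (Node I.k I.l × Node I.k I.l)}

theorem getElem_mem_edges (h : Represents G E) {a : ℕ} (ha : a < E.length) :
    E[a] ∈ I.network.edges := by
  rw [← h.edges_eq, List.mem_toFinset]
  exact List.getElem_mem ha

theorem exists_getElem (h : Represents G E) {e : Node I.k I.l × Node I.k I.l}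
    (he : e ∈ I.network.edges) : ∃ (a : ℕ) (ha : a < E.length), E[a] = e := by
  rw [← h.edges_eq, List.mem_toFinset] at he
  exact List.getElem_of_mem he

theorem sum_edges (h : Represents G E) {M : Type*} [AddCommMonoid M]
    (F : Node I.k I.l × Node I.k I.l → M) (φ : ℕ → M)
    (hφ : ∀ a (ha : a < E.length), φ a = F E[a]) :
    ∑ e ∈ I.network.edges, F e = ∑ a ∈ Finset.range E.length, φ a := by
  rw [← h.edges_eq, List.sum_toFinset _ h.nodup, Finset.sum_range]
  simp only [hφ _ (Fin.is_lt _)]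
  rw [Fin.sum_univ_fun_getElem E F]

theorem layered (h : Represents G E) (hI : I.IsRPC1) : FlowProgram.Layered G := by
  intro a ha
  rw [h.m_eq] at ha
  rw [h.head a ha, h.tail a ha, h.cost a ha]
  rcases Instance.mem_network_edges.1 (h.getElem_mem_edges ha) with
    ⟨i, -, he⟩ | ⟨p, -, he⟩ | ⟨j, hj, he⟩ <;> rw [he]
  · refine ⟨?_, .inl ⟨?_, rfl, rfl⟩⟩ <;> simp only [Node.code] <;> omega
  · refine ⟨?_, .inr (.inl ⟨?_, ?_⟩)⟩ <;> simp only [Node.code] <;> omega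
  -- Isolated vertices have been removed from `H`, so some pair enters the rider; its arc is the `b`
  -- that `Layered` asks for.
  · obtain ⟨i, hi⟩ := (Instance.mem_riders hI).1 hj
    obtain ⟨b, hb, heb⟩ := h.exists_getElem (Instance.driver_rider_mem_edges.2 hi)
    refine ⟨by simp [Node.code], .inr (.inr ⟨le_rfl, rfl, ?_, b, h.m_eq ▸ hb, ?_⟩)⟩
    · simp only [Node.code]
      omega
    · rw [h.head b hb, heb]

/-- The flow in the network with the values `x`. -/
noncomputable def toFlow (E : List (Node I.k I.l × Node I.k I.l)) (x : ℕ → ℤ)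
    (e : Node I.k I.l × Node I.k I.l) : ℝ :=
  if e ∈ E then (x (E.idxOf e) : ℝ) else 0

theorem toFlow_getElem (h : Represents G E) (x : ℕ → ℤ) {a : ℕ} (ha : a < E.length) :
    toFlow E x E[a] = x a := by
  rw [toFlow, if_pos (List.getElem_mem ha), h.nodup.idxOf_getElem]

variable {y : ℤ} {x : ℕ → ℤ}

theorem netOut_toFlow (h : Represents G E) (x : ℕ → ℤ) (v : Node I.k I.l) :
    I.network.netOut (toFlow E x) v = G.balance x v.code := by
  rw [FlowNetwork.netOut_eq_sum, ArcList.balance, h.m_eq, Int.cast_sum]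
  refine h.sum_edges _ _ fun a ha => ?_
  rw [h.toFlow_getElem x ha, h.tail a ha, h.head a ha]
  simp [Node.code_injective.eq_iff]

theorem isFlow_toFlow (h : Represents G E) (hx : G.IsCertifiedFlow y x) :
    I.network.IsFlow (toFlow E x) where
  nonneg e := by
    by_cases he : e ∈ E
    · obtain ⟨a, ha, rfl⟩ := List.getElem_of_mem he
      obtain ⟨φ, hφ⟩ := hx.1
      rw [h.toFlow_getElem x ha]
      rcases (hφ a (h.m_eq ▸ ha)).1 with h0 | h0 <;> simp [h0]
    · rw [toFlow, if_neg he]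
  le_cap e he := by
    obtain ⟨a, ha, rfl⟩ := h.exists_getElem he
    obtain ⟨φ, hφ⟩ := hx.1
    rw [h.toFlow_getElem x ha]
    rcases (hφ a (h.m_eq ▸ ha)).1 with h0 | h0 <;> simp [h0, Instance.network]
  eq_zero e he := by
    rw [← h.edges_eq, List.mem_toFinset] at he
    rw [toFlow, if_neg he]
  conservation v hs ht := by
    rw [h.netOut_toFlow, hx.2, if_neg, if_neg]
    · simp
    · exact fun hv => ht (Node.code_injective (a₁ := v) (a₂ := .sink) hv.symm)
    · exact fun hv => hs (Node.code_injective (a₁ := v) (a₂ := .source) hv.symm)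

theorem value_toFlow (h : Represents G E) (hx : G.IsCertifiedFlow y x) :
    I.network.value (toFlow E x) = y := by
  rw [FlowNetwork.value, h.netOut_toFlow, hx.2]
  simp [Instance.network, Node.code]

theorem source_ne_sink : I.network.source ≠ I.network.sink := by
  simp [Instance.network]

/-- A feasible potential shows that the cost is minimum. -/
theorem isIntegralMinCostFlow (h : Represents G E) {y : ℕ} (hx : G.IsCertifiedFlow y x) :
    I.network.IsIntegralMinCostFlow y (toFlow E x) where
  isFlow := h.isFlow_toFlow hx
  value_eq := by simpa using h.value_toFlow hx
  integral e := by
    rw [toFlow]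
    split_ifs
    · exact ⟨_, rfl⟩
    · exact ⟨0, by simp⟩
  le_cost g hg hgy := by
    obtain ⟨φ, hφ⟩ := hx.1
    have h1 := FlowNetwork.sum_potential_diff _ (h.isFlow_toFlow hx) source_ne_sink
      fun v => (φ v.code : ℝ)
    have h2 := FlowNetwork.sum_potential_diff _ hg source_ne_sink fun v => (φ v.code : ℝ)
    have hv : I.network.value (toFlow E x) = y := by simpa using h.value_toFlow hx
    rw [hv] at h1
    rw [hgy] at h2
    -- Complementary slackness on each edge: where `x` is 0 the reduced cost of the edge is
    -- nonnegative and `g ≥ 0`; where `x` is 1 it is nonpositive and `g ≤ 1`. The potential terms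
    -- depend only on the value and cancel afterwards.
    have key : ∑ e ∈ I.network.edges, ((I.network.cost e : ℝ) * toFlow E x e +
          toFlow E x e * ((φ e.1.code : ℝ) - φ e.2.code)) ≤
        ∑ e ∈ I.network.edges, ((I.network.cost e : ℝ) * g e +
          g e * ((φ e.1.code : ℝ) - φ e.2.code)) := by
      refine Finset.sum_le_sum fun e he => ?_
      obtain ⟨a, ha, rfl⟩ := h.exists_getElem he
      obtain ⟨h01, hr⟩ := hφ a (h.m_eq ▸ ha)
      have hg0 := hg.nonneg E[a]
      have hg1 : g E[a] ≤ 1 := by simpa [Instance.network] using hg.le_cap _ he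
      rw [h.toFlow_getElem x ha]
      rcases h01 with h0 | h0
      · simp only [ArcList.redCost, ArcList.resCost, ArcList.src, ArcList.dst, h0, if_true,
          h.tail a ha, h.head a ha, h.cost a ha] at hr
        have hr' : (0 : ℝ) ≤ I.network.cost E[a] + φ E[a].1.code - φ E[a].2.code := by
          exact_mod_cast hr
        rw [h0, Int.cast_zero]
        nlinarith [mul_nonneg hg0 hr']
      · simp only [ArcList.redCost, ArcList.resCost, ArcList.src, ArcList.dst, h0, one_ne_zero,
          if_false, h.tail a ha, h.head a ha, h.cost a ha] at hr
        have hr' : (0 : ℝ) ≤ - I.network.cost E[a] + φ E[a].2.code - φ E[a].1.code := by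
          exact_mod_cast hr
        rw [h0, Int.cast_one]
        nlinarith [mul_nonneg (sub_nonneg.2 hg1) hr']
    rw [Finset.sum_add_distrib, Finset.sum_add_distrib, h1, h2] at key
    simpa [FlowNetwork.flowCost] using key

/-- A saturated cut shows that there is no flow of larger value. -/
theorem not_exists_flow (h : Represents G E) {y : ℕ} (hc : G.IsCutOff y) :
    ¬ ∃ g, I.network.IsFlow g ∧ I.network.value g = y := by
  classical
  rintro ⟨g, hg, hgy⟩
  obtain ⟨S, x, z, h0, h1, hzy, hx, hS⟩ := hc
  -- With the indicator of `S` as potential, `sum_potential_diff` says that the net flow across the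
  -- cut is the value.
  let χ : Node I.k I.l → ℝ := fun v => if v.code ∈ S then 1 else 0
  have hs : χ I.network.source = 1 := if_pos h0
  have ht : χ I.network.sink = 0 := if_neg h1
  have h1 := FlowNetwork.sum_potential_diff _ (h.isFlow_toFlow hx) source_ne_sink χ
  have h2 := FlowNetwork.sum_potential_diff _ hg source_ne_sink χ
  rw [h.value_toFlow hx, hs, ht] at h1
  rw [hgy, hs, ht] at h2
  -- Closedness of `S` under residual arcs means that edges leaving `S` are full in `x` and edges
  -- entering `S` are empty, so no flow sends more across.
  have key : ∑ e ∈ I.network.edges, g e * (χ e.1 - χ e.2) ≤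
      ∑ e ∈ I.network.edges, toFlow E x e * (χ e.1 - χ e.2) := by
    refine Finset.sum_le_sum fun e he => ?_
    obtain ⟨a, ha, rfl⟩ := h.exists_getElem he
    obtain ⟨φ, hφ⟩ := hx.1
    have hSa := hS a (h.m_eq ▸ ha)
    have hg0 := hg.nonneg E[a]
    have hg1 : g E[a] ≤ 1 := by simpa [Instance.network] using hg.le_cap _ he
    rw [h.toFlow_getElem x ha]
    simp only [χ]
    rcases (hφ a (h.m_eq ▸ ha)).1 with hx0 | hx0 <;>
      simp only [ArcList.src, ArcList.dst, hx0, if_true, one_ne_zero, if_false, h.tail a ha,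
        h.head a ha] at hSa <;>
      by_cases hu : E[a].1.code ∈ S <;> by_cases hw : E[a].2.code ∈ S <;>
      simp only [hu, hw, hx0, if_true, if_false, true_imp_iff, Int.cast_zero, Int.cast_one]
        at hSa ⊢ <;> linarith
  rw [h1, h2] at key
  have : ((y : ℤ) : ℝ) ≤ z := by push_cast; linarith
  have : (y : ℤ) ≤ z := by exact_mod_cast this
  omega

end Represents

/-! ### The program that selects the answer -/

namespace SelectProgram

open RAM

/-- Row `j` of the flows in the state `σ` holds a flow whose cost meets the target. -/
def MeetsTarget (σ : State) (m : ℕ) (j : ℕ) : Prop :=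
  σ.mem 9 ((j + 1 : ℕ) : ℤ) = 1 ∧
    ∑ a ∈ Finset.range m, (if 1 ≤ σ.mem 10 ((j * m + a : ℕ) : ℤ) then σ.mem 8 a else 0) ≤ -σ.reg 3

/-- Register `32` becomes the cost of the edges with positive flow in the row at `reg 31`. -/
def sumCosts : Prog :=
  .seq (.assign 32 (.const 0)) (.count 34 4
    (.ite (.le (.const 1) (.load 10 (.add (.reg 31) (.reg 34))))
      (.assign 32 (.add (.reg 32) (.load 8 (.reg 34)))) .skip))

theorem runs_sumCosts {σ : State} {m b : ℕ} (hm : σ.reg 4 = m) (hb : σ.reg 31 = b) :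
    Runs sumCosts σ (m * 30 + 10) fun τ => τ.reg 32 =
      ∑ a ∈ Finset.range m, if 1 ≤ σ.mem 10 ((b + a : ℕ) : ℤ) then σ.mem 8 a else 0 := by
  refine (Runs.seq (R := fun τ => τ = σ.setReg 32 0) (.assign rfl)
    (U := m * (21 + 9) + 7) ?_).mono (by simp only [Expr.steps]; omega) fun _ _ h => h
  rintro _ - rfl
  refine Runs.count m 21 (fun j τ => τ.reg 32 =
    ∑ a ∈ Finset.range j, if 1 ≤ σ.mem 10 ((b + a : ℕ) : ℤ) then σ.mem 8 a else 0)
    (by simpa using hm) rfl rfl (by decide) (by simp) ?_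
  intro j hj τ hF hi hI
  have h10 : τ.mem 10 = σ.mem 10 := hF.mem 10 rfl
  have h8 : τ.mem 8 = σ.mem 8 := hF.mem 8 rfl
  have h31 : τ.reg 31 = b := by rw [hF.reg 31 rfl]; simpa using hb
  refine (Runs.ite (T := 6) (fun hc => .loopFree rfl (by decide) ?_)
    fun hc => .loopFree rfl (by decide) ?_).mono (by decide) fun _ _ h => h <;>
  · simp only [Cond.holds, Expr.eval, hi, h10, h31, ← Nat.cast_add] at hc
    rw [Finset.sum_range_succ]
    simp only [hc, if_true, if_false, add_zero]
    simp [Prog.out, Expr.eval, hi, hI, h8]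

/-- Remember the row of index `reg 33` if it meets the target. -/
def chooseBody : Prog :=
  .seq (.ite (.eq (.load 9 (.add (.reg 33) (.const 1))) (.const 1))
    (.seq sumCosts (.ite (.le (.reg 32) (.sub (.const 0) (.reg 3)))
      (.seq (.assign 5 (.const 1)) (.assign 35 (.reg 31))) .skip)) .skip)
    (.assign 31 (.add (.reg 31) (.reg 4)))

/-- Remember the last row that meets the target. -/
def choose : Prog :=
  .seq (.seq (.assign 5 (.const 0)) (.assign 31 (.const 0))) (.count 33 10 chooseBody)

/-- What has been remembered after `n` rows. -/
def Chosen (σ : State) (m n : ℕ) (τ : State) : Prop :=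
  (τ.reg 5 = 0 ∧ ∀ j < n, ¬ MeetsTarget σ m j) ∨
    (τ.reg 5 = 1 ∧ ∃ j < n, τ.reg 35 = (j * m : ℕ) ∧ MeetsTarget σ m j ∧
      ∀ i < n, MeetsTarget σ m i → i ≤ j)

theorem Chosen.skip {σ τ ρ : State} {m n : ℕ} (h : Chosen σ m n τ) (hn : ¬ MeetsTarget σ m n)
    (h5 : ρ.reg 5 = τ.reg 5) (h35 : ρ.reg 35 = τ.reg 35) : Chosen σ m (n + 1) ρ := by
  have aux : ∀ {i}, i < n + 1 → MeetsTarget σ m i → i < n := fun hi hM =>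
    lt_of_le_of_ne (Nat.lt_succ_iff.1 hi) fun e => hn (e ▸ hM)
  rw [Chosen, h5, h35]
  rcases h with ⟨h0, hno⟩ | ⟨h1, j, hj, hr, hM, hmax⟩
  · exact .inl ⟨h0, fun i hi hMi => hno i (aux hi hMi) hMi⟩
  · exact .inr ⟨h1, j, hj.trans n.lt_succ_self, hr, hM, fun i hi hMi => hmax i (aux hi hMi) hMi⟩

/-- Rows are visited in increasing order and a later success overwrites an earlier one, so the
remembered row is the largest that meets the target. -/
theorem runs_choose {σ : State} {m N : ℕ} (hm : σ.reg 4 = m) (hN : σ.reg 10 = N) :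
    Runs choose σ (N * (m * 30 + 60) + 20) (Chosen σ m N) := by
  refine (Runs.seq (R := fun τ => τ = (σ.setReg 5 0).setReg 31 0) (T := 4)
    (.loopFree rfl (by decide) rfl) (U := N * (m * 30 + 51 + 9) + 7) ?_).mono
      (by rw [Nat.add_assoc (m * 30)]; omega) fun _ _ h => h
  rintro _ - rfl
  refine (Runs.count N (m * 30 + 51) (fun j τ => τ.reg 31 = (j * m : ℕ) ∧ Chosen σ m j τ)
    (by simpa using hN) rfl rfl (by decide) ⟨by simp, .inl ⟨by simp, by omega⟩⟩ ?_).mono le_rfl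
      fun _ _ h => h.2
  rintro j hj τ hF hi ⟨h31, hI⟩
  have h9 : τ.mem 9 = σ.mem 9 := hF.mem 9 rfl
  have h10 : τ.mem 10 = σ.mem 10 := hF.mem 10 rfl
  have h8 : τ.mem 8 = σ.mem 8 := hF.mem 8 rfl
  have h4 : τ.reg 4 = m := by rw [hF.reg 4 rfl]; simpa using hm
  have h3 : τ.reg 3 = σ.reg 3 := hF.reg 3 rfl
  refine (Runs.seq (R := fun ρ => Chosen σ m (j + 1) ρ ∧ ρ.reg 31 = τ.reg 31 ∧ ρ.reg 4 = τ.reg 4)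
    (T := m * 30 + 40) ?_ (U := 4) ?_).mono (by omega) fun _ _ h => h
  · refine (Runs.ite (T := m * 30 + 30) (fun hc => ?_) fun hc => .loopFree rfl ?_ ?_).mono
      (by simp only [Cond.steps, Expr.steps]; omega) fun _ _ h => h
    · simp only [Cond.holds, Expr.eval, hi, h9, ← Nat.cast_succ] at hc
      refine (Runs.seq (runs_sumCosts h4 h31) (U := 20) ?_).mono (by omega) fun _ _ h => h
      intro ρ hFρ h32
      have r3 : ρ.reg 3 = σ.reg 3 := (hFρ.reg 3 rfl).trans h3
      have r31 : ρ.reg 31 = τ.reg 31 := hFρ.reg 31 rfl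
      have r4 : ρ.reg 4 = τ.reg 4 := hFρ.reg 4 rfl
      rw [h10, h8] at h32
      refine (Runs.ite (T := 6) (fun hc' => .loopFree rfl (by decide) ?_)
        fun hc' => .loopFree rfl (by decide) ?_).mono (by decide) fun _ _ h => h
      · simp only [Cond.holds, Expr.eval, h32, r3, zero_sub] at hc'
        refine ⟨.inr ⟨by simp [Prog.out, Expr.eval], j, j.lt_succ_self,
          by simp [Prog.out, Expr.eval, r31, h31], ⟨hc, hc'⟩, fun i hi' _ => by omega⟩, ?_, ?_⟩
        · simp [Prog.out, r31]
        · simp [Prog.out, r4]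
      · simp only [Cond.holds, Expr.eval, h32, r3, zero_sub] at hc'
        exact ⟨hI.skip (fun h => hc' h.2) (hFρ.reg 5 rfl) (hFρ.reg 35 rfl), r31, r4⟩
    · simp only [Prog.bound]
      omega
    · simp only [Cond.holds, Expr.eval, hi, h9, ← Nat.cast_succ] at hc
      exact ⟨hI.skip (fun h => hc h.1) rfl rfl, rfl, rfl⟩
  · rintro ρ - ⟨hC, r31, r4⟩
    refine .loopFree rfl (by decide) ⟨?_, ?_⟩
    · simp [Prog.out, Expr.eval, r31, r4, h31, h4]
      ring
    · simpa [Prog.out, Chosen] using hC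

/-- Output the edge of index `reg 33` if it has positive flow in the row at `reg 35`. -/
def outputBody : Prog :=
  .ite (.le (.const 1) (.load 10 (.add (.add (.reg 35) (.reg 0)) (.reg 33))))
    (.seq (.store 11 (.reg 6) (.load 2 (.reg 33))) (.seq (.store 12 (.reg 6) (.load 3 (.reg 33)))
      (.assign 6 (.add (.reg 6) (.const 1))))) .skip

/-- Output the edges of `H` with positive flow. -/
def output : Prog := .seq (.assign 6 (.const 0)) (.count 33 2 outputBody)

/-- The entries of the list `K` are in the output arrays. -/
def IsOutput {α : Type*} (u w : α → ℤ) (K : List α) (τ : State) : Prop :=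
  τ.reg 6 = K.length ∧ ∀ (a : ℕ) (h : a < K.length), τ.mem 11 a = u K[a] ∧ τ.mem 12 a = w K[a]

/-- In its use `b` is the start of the chosen row and `d` the number of source edges, whose flow
values precede those of the edges of `H`. -/
theorem runs_output {α : Type*} {u w : α → ℤ} {K : List α} {p : α → Bool} {σ : State} {b d : ℕ}
    (hK : σ.reg 2 = K.length) (hb : σ.reg 35 = b) (hd : σ.reg 0 = d)
    (hu : ∀ (a : ℕ) (h : a < K.length), σ.mem 2 a = u K[a])
    (hw : ∀ (a : ℕ) (h : a < K.length), σ.mem 3 a = w K[a])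
    (hp : ∀ (a : ℕ) (h : a < K.length), 1 ≤ σ.mem 10 ((b + d + a : ℕ) : ℤ) ↔ p K[a] = true) :
    Runs output σ (K.length * 40 + 10) (IsOutput u w (K.filter p)) := by
  refine (Runs.seq (R := fun τ => τ = σ.setReg 6 0) (.assign rfl)
    (U := K.length * (31 + 9) + 7) ?_).mono (by simp only [Expr.steps]; omega) fun _ _ h => h
  rintro _ - rfl
  refine (Runs.count K.length 31 (fun j τ => IsOutput u w ((K.take j).filter p) τ)
    (by simpa using hK) rfl rfl (by decide) ⟨by simp, by simp⟩ ?_).mono le_rfl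
      fun τ _ h => by rwa [List.take_length] at h
  rintro j hj τ hF hi ⟨h6, hI⟩
  have h10 : τ.mem 10 = σ.mem 10 := hF.mem 10 rfl
  have h2 : τ.mem 2 j = u K[j] := by rw [hF.mem 2 rfl]; exact hu j hj
  have h3 : τ.mem 3 j = w K[j] := by rw [hF.mem 3 rfl]; exact hw j hj
  have h35 : τ.reg 35 = b := by rw [hF.reg 35 rfl]; simpa using hb
  have h0 : τ.reg 0 = d := by rw [hF.reg 0 rfl]; simpa using hd
  have htake : K.take (j + 1) = K.take j ++ [K[j]] := (List.take_concat_get' _ _ hj).symm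
  refine (Runs.ite (T := 12) (fun hc => .loopFree rfl (by decide) ?_)
    fun hc => .loopFree rfl (by decide) ?_).mono (by decide) fun _ _ h => h
  · simp only [Cond.holds, Expr.eval, hi, h10, h35, h0, ← Nat.cast_add, hp j hj] at hc
    rw [htake, List.filter_append, List.filter_singleton, hc]
    refine ⟨by simp [Prog.out, Expr.eval, h6], fun a ha => ?_⟩
    simp only [cond_true, List.length_append, List.length_singleton] at ha
    simp only [cond_true, Prog.out, Expr.eval, State.setReg_mem, State.setMem_mem,
      State.setMem_reg, h6, hi, h2, h3]
    rcases Nat.lt_succ_iff_lt_or_eq.1 ha with ha | rfl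
    · rw [List.getElem_append_left ha]
      simpa [ha.ne] using hI a ha
    · rw [List.getElem_concat_length rfl]
      simp
  · simp only [Cond.holds, Expr.eval, hi, h10, h35, h0, ← Nat.cast_add, hp j hj] at hc
    rw [Bool.not_eq_true] at hc
    rw [htake, List.filter_append, List.filter_singleton, hc]
    simpa [IsOutput, Prog.out] using ⟨h6, hI⟩

/-- Step 3 of ExactNF. -/
def select : Prog :=
  .seq FlowProgram.setMin (.seq choose (.ite (.eq (.reg 5) (.const 1)) output .skip))

/-- A bound for the number of steps of the program `select`. -/
def selectBound (m N : ℕ) : ℕ := N * (m * 30 + 60) + m * 40 + 50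

end SelectProgram

open RAM

/-! ### Interpreting the memory as flows and assembling the three steps -/

namespace Instance

/-- The flows that are stored in the state `σ`. -/
noncomputable def storedFamily (E : List (Node I.k I.l × Node I.k I.l)) (σ : State) (y : ℕ) :
    Option (Node I.k I.l × Node I.k I.l → ℝ) :=
  if σ.mem 9 y = 1 then
    some (Represents.toFlow E fun a => σ.mem 10 (((y - 1) * E.length + a : ℕ) : ℤ))
  else none

variable {G : ArcList} {E : List (Node I.k I.l × Node I.k I.l)} {σ : State}

/-- The certificates in `Solved` are turned into statements about all real flows: the potential into
minimality, the cut into nonexistence. -/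
theorem isMinCostFlowFamily_storedFamily (h : Represents G E)
    (hS : FlowProgram.Solved G I.nMin σ) : I.IsMinCostFlowFamily (storedFamily E σ) := by
  intro y h1 hy
  rcases hS y h1 hy with ⟨h9, hx⟩ | ⟨h9, hc⟩
  · rw [storedFamily, if_pos h9]
    rw [h.m_eq] at hx
    exact h.isIntegralMinCostFlow hx
  · rw [storedFamily, if_neg (by omega)]
    exact h.not_exists_flow hc

theorem storesFlows_storedFamily (h : Represents G E) (hS : FlowProgram.Solved G I.nMin σ) :
    I.StoresFlows E (storedFamily E σ) σ := by
  intro y h1 hy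
  rcases hS y h1 hy with ⟨h9, -⟩ | ⟨h9, -⟩
  · rw [storedFamily, if_pos h9]
    exact ⟨h9, fun a ha => (h.toFlow_getElem
      (fun a => σ.mem 10 (((y - 1) * E.length + a : ℕ) : ℤ)) ha).symm⟩
  · rw [storedFamily, if_neg (by omega)]
    exact h9

/-- Row `j` belongs to the value `j + 1`. For the integers in memory the program's test `1 ≤ x` is
the positivity of the real flow. -/
theorem meetsTarget_iff (h : Represents G E) (hG : FlowProgram.HasArcs G σ) (j : ℕ) :
    SelectProgram.MeetsTarget σ E.length j ↔
      ∃ g, storedFamily E σ (j + 1) = some g ∧ I.network.supportCost g ≤ -σ.reg 3 := by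
  classical
  by_cases h9 : σ.mem 9 ((j + 1 : ℕ) : ℤ) = 1
  · have hcost : I.network.supportCost (Represents.toFlow E fun a =>
        σ.mem 10 ((j * E.length + a : ℕ) : ℤ)) = ∑ a ∈ Finset.range E.length,
          if 1 ≤ σ.mem 10 ((j * E.length + a : ℕ) : ℤ) then σ.mem 8 a else 0 := by
      rw [FlowNetwork.supportCost, Finset.sum_filter]
      refine h.sum_edges _ _ fun a ha => ?_
      simp only [h.toFlow_getElem _ ha, hG.cost, h.cost a ha, Int.cast_pos, Int.lt_iff_add_one_le,
        zero_add]
    simp only [SelectProgram.MeetsTarget, storedFamily, h9, true_and, if_true, Option.some.injEq,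
      exists_eq_left', Nat.add_sub_cancel, hcost]
  · rw [SelectProgram.MeetsTarget, storedFamily, if_neg h9]
    simp only [h9, false_and, reduceCtorEq, exists_false]

end Instance

open Instance SelectProgram BuildProgram

theorem storesAnswer_of_output {g : Node I.k I.l × Node I.k I.l → ℝ} {L : I.Listing}
    {p : Fin I.k × Fin I.l → Bool}
    (hp : ∀ q, p q = true ↔ 0 < g (.driver q.1, .rider q.2)) {τ : State}
    (h5 : τ.reg 5 = 1) (hO : IsOutput (fun q : Fin I.k × Fin I.l => ((q.1 : ℕ) : ℤ))
      (fun q => ((q.2 : ℕ) : ℤ)) (L.pairList.filter p) τ) :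
    I.StoresAnswer τ (some (I.flowEdges g)) := by
  classical
  refine ⟨h5, L.pairList.filter p, L.nodup_pairs.filter _, ?_, hO.1, fun a ha => (hO.2 a ha).1,
    fun a ha => (hO.2 a ha).2⟩
  rw [flowEdges_eq, pairEdges, flowPairs, ← L.pairs_eq]
  congr 1
  ext q
  simp [hp]

theorem length_driverList (L : I.Listing) : L.driverList.length = I.drivers.card := by
  rw [← L.drivers_eq, List.toFinset_card_of_nodup L.nodup_drivers]

theorem length_riderList (L : I.Listing) : L.riderList.length = I.riders.card := by
  rw [← L.riders_eq, List.toFinset_card_of_nodup L.nodup_riders]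

theorem runs_select {G : ArcList} {L : I.Listing} {c : ℤ} {σ : State}
    (h : Represents G (edgeList L)) (hG : FlowProgram.HasArcs G σ)
    (hreg : ∀ r < 4, σ.reg r = (I.inputState L c).reg r)
    (hmem : ∀ a < 5, σ.mem a = (I.inputState L c).mem a) :
    Runs select σ (selectBound (edgeList L).length I.nMin) fun τ =>
      I.StoresAnswer τ (I.exactNF c (storedFamily (edgeList L) σ)) := by
  classical
  set m := (edgeList L).length with hm
  have hN : min L.driverList.length L.riderList.length = I.nMin := by
    rw [length_driverList, length_riderList, nMin]
  have hd : σ.reg 0 = L.driverList.length := hreg 0 (by decide)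
  have hr : σ.reg 1 = L.riderList.length := hreg 1 (by decide)
  have hq : σ.reg 2 = L.pairList.length := hreg 2 (by decide)
  have hc : σ.reg 3 = c := hreg 3 (by decide)
  have hlen := length_edgeList L
  refine (Runs.seq (FlowProgram.runs_setMin hd hr)
    (U := I.nMin * (m * 30 + 60) + 20 + (m * 40 + 20)) ?_).mono
      (by simp only [selectBound]; omega) fun _ _ h => h
  intro τ hF h10
  rw [hN] at h10
  refine Runs.seq (runs_choose (m := m) (by rw [hF.reg 4 rfl, hG.count, h.m_eq]) h10) ?_
  intro ρ hFρ hC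
  have hmeets : ∀ j, MeetsTarget τ m j ↔ ∃ g, storedFamily (edgeList L) σ (j + 1) = some g ∧
      I.network.supportCost g ≤ -c := by
    intro j
    rw [← hc, ← meetsTarget_iff h hG j, MeetsTarget, MeetsTarget, hF.mem 9 rfl, hF.mem 10 rfl,
      hF.mem 8 rfl, hF.reg 3 rfl]
  refine (Runs.ite (T := m * 40 + 10) (fun hb => ?_) fun hb => .loopFree rfl ?_ ?_).mono
    (by simp only [Cond.steps, Expr.steps]; omega) fun _ _ h => h
  · simp only [Cond.holds, Expr.eval] at hb
    rcases hC with ⟨h0, -⟩ | ⟨h1, j, hj, h35, hM, hmax⟩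
    · omega
    obtain ⟨g, hg, hgc⟩ := (hmeets j).1 hM
    have hex : I.exactNF c (storedFamily (edgeList L) σ) = some (I.flowEdges g) := by
      have hjY : j + 1 ∈ {y ∈ Finset.Icc 1 I.nMin | ∃ g, storedFamily (edgeList L) σ y = some g ∧
          I.network.supportCost g ≤ -c} :=
        Finset.mem_filter.2 ⟨Finset.mem_Icc.2 ⟨by omega, hj⟩, g, hg, hgc⟩
      simp only [exactNF]
      rw [dif_pos ⟨_, hjY⟩]
      -- Rows are numbered from 0 and flow values from 1, so maximality of row `j` becomes
      -- maximality of `j + 1`.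
      have : Finset.max' _ ⟨_, hjY⟩ = j + 1 := by
        refine le_antisymm (Finset.max'_le _ _ _ fun y hy => ?_) (Finset.le_max' _ _ hjY)
        obtain ⟨hy, hex⟩ := Finset.mem_filter.1 hy
        have hy1 := Finset.mem_Icc.1 hy
        have := hmax (y - 1) (by omega)
          ((hmeets _).2 (by rwa [Nat.sub_add_cancel hy1.1]))
        omega
      rw [this, hg, Option.map_some]
    rw [hex]
    have hgx : g = Represents.toFlow (edgeList L) fun a =>
        σ.mem 10 ((j * (edgeList L).length + a : ℕ) : ℤ) := by
      rw [storedFamily] at hg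
      split_ifs at hg
      simpa using hg.symm
    have hmemρ : ∀ a, FlowProgram.setMin.writesMem a = false → choose.writesMem a = false →
        ρ.mem a = σ.mem a := fun a h1 h2 => (hFρ.mem a h2).trans (hF.mem a h1)
    refine (runs_output (u := fun q : Fin I.k × Fin I.l => ((q.1 : ℕ) : ℤ))
      (w := fun q => ((q.2 : ℕ) : ℤ)) (p := fun q => decide (0 < g (.driver q.1, .rider q.2)))
      (K := L.pairList) (b := j * m) (d := L.driverList.length) ?_ h35 ?_ ?_ ?_ ?_).mono
      (by omega) fun τ' hF' hO => ?_
    · rw [hFρ.reg 2 rfl, hF.reg 2 rfl, hq]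
    · rw [hFρ.reg 0 rfl, hF.reg 0 rfl, hd]
    · intro a ha
      rw [hmemρ 2 rfl rfl, hmem 2 (by decide)]
      exact (arrayOf_getElem (by simpa using ha)).trans (by simp)
    · intro a ha
      rw [hmemρ 3 rfl rfl, hmem 3 (by decide)]
      exact (arrayOf_getElem (by simpa using ha)).trans (by simp)
    · intro a ha
      -- The edge list starts with one source edge per driver, so this is the index of the edge of
      -- pair `a`.
      have hlt : L.driverList.length + a < (edgeList L).length := by omega
      have he : (edgeList L)[L.driverList.length + a] =
          (.driver L.pairList[a].1, .rider L.pairList[a].2) := by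
        simp [edgeList, ha]
      have hval := h.toFlow_getElem (fun a => σ.mem 10 ((j * (edgeList L).length + a : ℕ) : ℤ)) hlt
      rw [← hgx, he] at hval
      rw [hmemρ 10 rfl rfl, decide_eq_true_iff, hval, Int.cast_pos, ← Nat.add_assoc,
        Int.lt_iff_add_one_le, zero_add]
    · exact storesAnswer_of_output (by simp) ((hF'.reg 5 rfl).trans h1) hO
  · simp only [Prog.bound]
    omega
  · simp only [Cond.holds, Expr.eval] at hb
    rcases hC with ⟨h0, hno⟩ | ⟨h1, -⟩
    swap
    · exact absurd h1 hb
    have hex : I.exactNF c (storedFamily (edgeList L) σ) = none := by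
      simp only [exactNF]
      rw [dif_neg]
      rintro ⟨y, hy⟩
      obtain ⟨hy, hex⟩ := Finset.mem_filter.1 hy
      have hy1 := Finset.mem_Icc.1 hy
      exact hno (y - 1) (by omega) ((hmeets _).2 (by rwa [Nat.sub_add_cancel hy1.1]))
    rw [hex]
    exact h0

/-- A bound for the number of steps of the three programs, on a network of size `s`. -/
noncomputable def timeBound : Polynomial ℕ :=
  let s : Polynomial ℕ := .X
  (s * 60 + 21) +
    (s * (((2 * s + 1) * (s * 114 + 64) + s * 87 + 100) + 4) + s * 60 + 40) +
    (s * (s * 30 + 60) + s * 40 + 50)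

theorem eval_timeBound (s : ℕ) : timeBound.eval s =
    buildBound s + FlowProgram.flowsBound s s + selectBound s s := by
  simp [timeBound, buildBound, FlowProgram.flowsBound, FlowProgram.phaseBound, selectBound]

theorem bounds_le_timeBound {m N s : ℕ} (hm : m ≤ s) (hN : N ≤ s) :
    buildBound m + FlowProgram.flowsBound m N + selectBound m N ≤ timeBound.eval s := by
  rw [eval_timeBound]
  simp only [buildBound, FlowProgram.flowsBound, FlowProgram.phaseBound, selectBound]
  gcongr

/-- The three programs carry out ExactNF in polynomial time. -/
theorem runsExactNF (hI : I.IsRPC1) (c : ℤ) (L : I.Listing) :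
    I.RunsExactNF build FlowProgram.flows select L c (timeBound.eval I.size) := by
  obtain ⟨σ₁, t₁, hE₁, ht₁, hS₁⟩ := runs_build L c
  have hF₁ := hE₁.frame
  -- The arc list is read off from the memory after `build`, also outside the range of edges. So
  -- `HasArcs`, which speaks of all indices, holds by definition.
  let G : ArcList := ⟨(edgeList L).length, fun a => σ₁.mem 5 a, fun a => σ₁.mem 6 a,
    fun a => σ₁.mem 8 a⟩
  have hA₁ : FlowProgram.HasArcs G σ₁ := ⟨hS₁.1, fun _ => rfl, fun _ => rfl, fun _ => rfl⟩
  have hR : Represents G (edgeList L) := ⟨nodup_edgeList L, edgeList_toFinset L, rfl,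
    fun a ha => (hS₁.2 a ha).1, fun a ha => (hS₁.2 a ha).2.1, fun a ha => (hS₁.2 a ha).2.2.2⟩
  have hreg₁ : ∀ r < 4, σ₁.reg r = (I.inputState L c).reg r := by
    intro r hr
    interval_cases r <;> exact hF₁.reg _ rfl
  have hmem₁ : ∀ a < 5, σ₁.mem a = (I.inputState L c).mem a := by
    intro a ha
    interval_cases a <;> exact hF₁.mem _ rfl
  have hN : min L.driverList.length L.riderList.length = I.nMin := by
    rw [length_driverList, length_riderList, nMin]
  obtain ⟨σ₂, t₂, hE₂, ht₂, hS₂⟩ := FlowProgram.runs_flows (hR.layered hI) hA₁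
    (hreg₁ 0 (by decide)) (hreg₁ 1 (by decide)) (by
      intro a ha v
      simp only [List.mem_cons, List.not_mem_nil, or_false] at ha
      rcases ha with rfl | rfl | rfl | rfl <;> rw [hF₁.mem _ rfl] <;> rfl)
  have hF₂ := hE₂.frame
  rw [hN] at ht₂ hS₂
  obtain ⟨σ₃, t₃, hE₃, ht₃, hS₃⟩ := runs_select hR
    (hA₁.of_frame hF₂ rfl rfl rfl rfl) (c := c)
    (by intro r hr; rw [← hreg₁ r hr]; interval_cases r <;> exact hF₂.reg _ rfl)
    (by intro a ha; rw [← hmem₁ a ha]; interval_cases a <;> exact hF₂.mem _ rfl)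
  have hfam := isMinCostFlowFamily_storedFamily hR hS₂
  refine ⟨edgeList L, storedFamily (edgeList L) σ₂, σ₁, σ₂, σ₃, t₁, t₂, t₃, hE₁, ?_, hE₂, hfam,
    storesFlows_storedFamily hR hS₂, hE₃, hS₃, hI.isCorrectAnswer_exactNF c hfam, ?_⟩
  · exact ⟨hR.nodup, hR.edges_eq, hS₁.1, hR.tail, hR.head, fun a ha => (hS₁.2 a ha).2.2.1, hR.cost⟩
  · have hm : (edgeList L).length ≤ I.size := by
      rw [← List.toFinset_card_of_nodup (nodup_edgeList L), edgeList_toFinset]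
      exact Nat.le_add_left _ _
    -- Each driver and each rider of `H` contributes an edge to the network, so the number of phases
    -- is bounded by the number of edges.
    have hle : I.nMin ≤ I.size := by
      have := length_edgeList L
      rw [← hN]
      omega
    exact le_trans (by gcongr) (bounds_le_timeBound hm hle)

end Ridesharing

theorem mainTheorem3 :
    (∀ I : Instance, I.IsRPC1 → ∀ (c : ℤ) (f : ℕ → Option (Node I.k I.l × Node I.k I.l → ℝ)),
      I.IsMinCostFlowFamily f → I.IsCorrectAnswer c (I.exactNF c f)) ∧
    (∃ (build flows select : RAM.Prog) (p : Polynomial ℕ),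
      ∀ I : Instance, I.IsRPC1 → ∀ (c : ℤ) (L : I.Listing),
        I.RunsExactNF build flows select L c (p.eval I.size)) :=
  ⟨fun _ hI c _ hf => hI.isCorrectAnswer_exactNF c hf,
    BuildProgram.build, FlowProgram.flows, SelectProgram.select, timeBound,
    fun _ hI c L => runsExactNF hI c L⟩
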